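/- \textbf{Setting.} For $n\in\mathbb N$ let $(X_n,Y_n)$ and $(X,Y)$ be bivariate real random vectors, each on some probability space, and write $F_Z$ for the distribution function of $Z$, $F_Z^{-1}(t)=\inf\{x: F_Z(x)\ge t\}$, and $F_Z(x-)=\lim_{y\uparrow x}F_Z(y)$. The Markov product of $(X,Y)$ is $(Y,Y')$, where $Y'$ has the same conditional distribution given $X$ as $Y$ and $Y,Y'$ are conditionally independent given $X$; similarly for $(Y_n,Y_n')$. A copula of a bivariate random vector $(V,W)$ is a bivariate copula $C$ with $P(V\le v,W\le w)=C(F_V(v),F_W(w))$ for all $v,w\in\mathbb R$. Let $C_{X_n,Y_n}$ and $C_{X,Y}$ be any copulas of $(X_n,Y_n)$ and $(X,Y)$. For a distribution function $G$ and a bivariate copula $C$ put, for $t\in(0,1)$, $u\in[0,1]$ and $x=G^{-1}(t)$, \[ \partial_1^{G}C(t,u)=\begin{cases}\dfrac{C(G(x),u)-C(G(x-),u)}{G(x)-G(x-)} & \text{if } G(x-)<G(x),\\[2mm] \partial_1 C(t,u) & \text{if } G(x-)=G(x),\end{cases} \] where $\partial_1$ denotes the partial derivative with respect to the first argument (which exists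 for almost all $t$), and let \[ C_{Y,Y'}(u,v)=\int_0^1\partial_1^{F_X}C_{X,Y}(t,u)\,\partial_1^{F_X}C_{X,Y}(t,v)\,dt,\qquad u,v\in[0,1]; \] define $C_{Y_n,Y_n'}$ in the same way from $C_{X_n,Y_n}$ and $F_{X_n}$. For non-degenerate $Y$, Chatterjee's rank correlation is \[ \xi(Y,X)=\frac{\int_{\mathbb R}\mathrm{Var}(P(Y\ge y\mid X))\,dP^Y(y)}{\int_{\mathbb R}\mathrm{Var}(\mathbf 1_{\{Y\ge y\}})\,dP^Y(y)} . \] \textbf{Theorem.} Assume that \begin{enumerate} \item[(i)] $\int_0^1|\partial_1C_{X_n,Y_n}(t,u)-\partial_1C_{X,Y}(t,u)|\,dt\to0$ for every $u\in[0,1]$, and \item[(ii)] $F_{X_n}(F_{X_n}^{-1}(t))\to F_X(F_X^{-1}(t))$ for Lebesgue-almost all $t\in(0,1)$. \end{enumerate} Then $C_{Y_n,Y_n'}$ is a copula of $(Y_n,Y_n')$ for every $n$, $C_{Y,Y'}$ is a copula of $(Y,Y')$, and $C_{Y_n,Y_n'}\to C_{Y,Y'}$ uniformly on $[0,1]^2$.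 If, in addition, $Y$ is not almost surely constant and \begin{enumerate} \item[(iii)] $F_{Y_n}(F_{Y_n}^{-1}(t))\to F_Y(F_Y^{-1}(t))$ for Lebesgue-almost all $t\in(0,1)$, \end{enumerate} then $\xi(Y_n,X_n)\to\xi(Y,X)$. (Under these assumptions $Y_n$ is not almost surely constant for all large $n$, so $\xi(Y_n,X_n)$ is well defined for those $n$.) -/

import Mathlib

open MeasureTheory ProbabilityTheory Filter Topology Set

noncomputable section

/-- A bivariate copula: (the restriction to `[0,1]²` of) a distribution function with uniform
margins on `[0,1]`.  Only the values of `C` on `[0,1]²` matter. -/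
structure IsCopula (C : ℝ → ℝ → ℝ) : Prop where
  zero_left : ∀ v ∈ Icc (0 : ℝ) 1, C 0 v = 0
  zero_right : ∀ u ∈ Icc (0 : ℝ) 1, C u 0 = 0
  one_left : ∀ v ∈ Icc (0 : ℝ) 1, C 1 v = v
  one_right : ∀ u ∈ Icc (0 : ℝ) 1, C u 1 = u
  two_increasing : ∀ u₁ ∈ Icc (0 : ℝ) 1, ∀ u₂ ∈ Icc (0 : ℝ) 1,
    ∀ v₁ ∈ Icc (0 : ℝ) 1, ∀ v₂ ∈ Icc (0 : ℝ) 1, u₁ ≤ u₂ → v₁ ≤ v₂ →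
      0 ≤ C u₂ v₂ - C u₁ v₂ - C u₂ v₁ + C u₁ v₁

/-- `C` is a copula of the probability measure `ν` on `ℝ²`, that is, the distribution function
of `ν` is `(x, y) ↦ C (F₁ x) (F₂ y)`, with `F₁`, `F₂` the marginal distribution functions.
(It is unique on the product of the ranges of `F₁` and `F₂`, but not elsewhere.) -/
def IsCopulaOf (C : ℝ → ℝ → ℝ) (ν : Measure (ℝ × ℝ)) : Prop :=
  IsCopula C ∧ ∀ x y : ℝ, ν.real (Iic x ×ˢ Iic y) = C (cdf ν.fst x) (cdf ν.snd y)

/-- The distribution function of the real random variable `Z`. -/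
def distFun {Ω : Type*} [MeasurableSpace Ω] (P : Measure Ω) (Z : Ω → ℝ) : ℝ → ℝ :=
  fun x => cdf (P.map Z) x

/-- The generalized inverse `F⁻¹(t) = inf {x | t ≤ F x}`, for `t ∈ (0,1)`. -/
def quantile (F : ℝ → ℝ) (t : ℝ) : ℝ := sInf {x | t ≤ F x}

/-- Range convergence: `Fₙ ∘ Fₙ⁻¹ (t) → F ∘ F⁻¹ (t)` for Lebesgue-almost all `t ∈ (0,1)`. -/
def RangeTendsto (F : ℕ → ℝ → ℝ) (F₀ : ℝ → ℝ) : Prop :=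
  ∀ᵐ t ∂(volume.restrict (Ioo (0 : ℝ) 1)),
    Tendsto (fun n => F n (quantile (F n) t)) atTop (𝓝 (F₀ (quantile F₀ t)))

/-- The partial derivative of `C` with respect to its first argument. -/
def partialFst (C : ℝ → ℝ → ℝ) (t u : ℝ) : ℝ := deriv (fun s => C s u) t

/-- `∂₁`-convergence: `∫₀¹ |∂₁ Cₙ(t,u) - ∂₁ C(t,u)| dt → 0` for every `u ∈ [0,1]`. -/
def PartialFstTendsto (C : ℕ → ℝ → ℝ → ℝ) (C₀ : ℝ → ℝ → ℝ) : Prop :=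
  ∀ u ∈ Icc (0 : ℝ) 1,
    Tendsto (fun n => ∫ t in Ioo (0 : ℝ) 1, |partialFst (C n) t u - partialFst C₀ t u|)
      atTop (𝓝 0)

open Classical in
/-- The generalized partial derivative `∂₁^G C (t,u)` of a copula with respect to a distribution
function `G`.  If `G` jumps at `G⁻¹(t)`, it is the difference quotient of `C(·,u)` over the jump
interval `[G(G⁻¹(t)-), G(G⁻¹(t))]`, which contains `t`; otherwise that interval is `{t}` and it is
the ordinary partial derivative at `t`. -/
def genPartialFst (G : ℝ → ℝ) (C : ℝ → ℝ → ℝ) (t u : ℝ) : ℝ :=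
  if Function.leftLim G (quantile G t) < G (quantile G t) then
    (C (G (quantile G t)) u - C (Function.leftLim G (quantile G t)) u) /
      (G (quantile G t) - Function.leftLim G (quantile G t))
  else partialFst C t u

/-- The (generalized) Markov product of the copula `C` with itself with respect to `G`,
`(C *_G C)(u,v) = ∫₀¹ ∂₁^G C(t,u) ∂₁^G C(t,v) dt`.  For a continuous distribution function `G` it
is the usual product `∫₀¹ ∂₁C(t,u) ∂₁C(t,v) dt`. -/
def markovCopula (G : ℝ → ℝ) (C : ℝ → ℝ → ℝ) (u v : ℝ) : ℝ :=
  ∫ t in Ioo (0 : ℝ) 1, genPartialFst G C t u * genPartialFst G C t v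

section

variable {Ω : Type*} [MeasurableSpace Ω]

/-- The law of the Markov product `(Y, Y')` of `(X, Y)`, where `Y'` has the same conditional
distribution given `X` as `Y`, and `Y`, `Y'` are conditionally independent given `X`: the mixture
over `x ∼ P^X` of the product measures `P^{Y|X=x} ⊗ P^{Y|X=x}`. -/
def markovProductLaw (P : Measure Ω) [IsFiniteMeasure P] (X Y : Ω → ℝ) : Measure (ℝ × ℝ) :=
  (P.map X).bind (condDistrib Y X P ×ₖ condDistrib Y X P)

/-- `markovProductLaw` is the joint law of `(Y, Y')` for every conditionally independent copy `Y'`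
of `Y` given `X`. -/
theorem map_prodMk_eq_markovProductLaw [StandardBorelSpace Ω] (P : Measure Ω)
    [IsProbabilityMeasure P] (X Y Y' : Ω → ℝ) (hX : Measurable X) (hY : Measurable Y)
    (hY' : Measurable Y') (h_copy : condDistrib Y' X P =ᵐ[P.map X] condDistrib Y X P)
    (h_indep : CondIndepFun (MeasurableSpace.comap X inferInstance) hX.comap_le Y Y' P) :
    P.map (fun ω => (Y ω, Y' ω)) = markovProductLaw P X Y := by
  have h := (condIndepFun_iff_map_prod_eq_prod_condDistrib_prod_condDistrib hY hY' hX).1 h_indep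
  have h2 : P.map (fun ω => (Y ω, Y' ω))
      = (P.map (fun ω => (X ω, Y ω, Y' ω))).snd := by
    rw [Measure.snd, Measure.map_map measurable_snd (by fun_prop)]
    rfl
  rw [h2, h, ← Measure.compProd_eq_comp_prod, Measure.snd_compProd, markovProductLaw]
  apply Measure.bind_congr_right
  filter_upwards [h_copy] with x hx
  rw [Kernel.prod_apply, Kernel.prod_apply, hx]

/-- Chatterjee's rank correlation
`ξ(Y,X) = ∫ Var(P(Y ≥ y | X)) dP^Y(y) / ∫ Var(1_{Y ≥ y}) dP^Y(y)`.
The denominator is positive unless `Y` is almost surely constant. -/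
def chatterjeeXi (P : Measure Ω) [IsFiniteMeasure P] (Y X : Ω → ℝ) : ℝ :=
  (∫ y, variance (fun ω => (condDistrib Y X P (X ω)).real (Ici y)) P ∂(P.map Y)) /
    (∫ y, variance ({ω | y ≤ Y ω}.indicator (fun _ => (1 : ℝ))) P ∂(P.map Y))

end

end

/-!
Let `Q` be the quantile function of a distribution function `F`. Under the uniform distribution on
`(0,1)`, the generalized partial derivative `t ↦ ∂₁^F C(t,u)` is the conditional expectation of the
ordinary partial derivative `t ↦ ∂₁ C(t,u)` given `Q` (`genPartialFst_ae_eq_condExp`): on the fiber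
of `Q` over an atom, which is the jump interval `[F(Q(t)-), F(Q(t))]`, it is the mean of `∂₁ C`, and
off these fibers `t = F(Q(t))` is a function of `Q(t)`. Two consequences carry the proof.

* As `Q` transports the uniform distribution to the law of `X`, uniqueness of conditional
  expectations identifies `∂₁^F C(t, F_Y(y))` with `P(Y ≤ y | X = Q(t))`
  (`condDistrib_quantile_ae_eq`). Hence the Markov product copula is a copula of the law of the
  Markov product (`isCopulaOf_markovCopula`).
* Conditional expectations are `L¹`-contractions, so that replacing `∂₁ Cₙ` by `∂₁ C` costs at most
  the `L¹`-distance of these derivatives. For the fixed copula `C`, convergence of the right ends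
  `Fₙ(Qₙ(t))` of the jump intervals entails convergence of the left ends (`ae_tendsto_jumpLeft`),
  and the difference quotients of `C(·,u)` over these intervals then converge, to the ordinary
  derivative if the limiting interval degenerates to `{t}`. So the generalized partial derivatives
  converge in `L¹` (`tendsto_integral_abs_genPartialFst_sub`) and the Markov product copulas
  converge pointwise, thus uniformly, copulas being `1`-Lipschitz in each argument.

Finally, if `M` is the Markov product copula and `L(t) = F_Y(F_Y⁻¹(t)-)`, then
`ξ(Y,X) = ∫ (M(L,L) - L²) / ∫ (L - L²)` (`chatterjeeXi_eq`). Range convergence for `Y` gives `L` as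
an almost everywhere limit, and dominated convergence concludes; the limiting denominator is
positive because `Y` is not degenerate.
-/

/-! ### Quantile functions and their jump intervals -/

/-- The uniform distribution on `(0,1)`. -/
noncomputable abbrev unif : Measure ℝ := volume.restrict (Ioo (0 : ℝ) 1)

instance : IsProbabilityMeasure unif := ⟨by simp [unif]⟩

lemma ae_unif_mem : ∀ᵐ t ∂unif, t ∈ Ioo (0 : ℝ) 1 := ae_restrict_mem measurableSet_Ioo

/-- The left end `F(F⁻¹(t)-)` of the jump interval of `F = cdf μ` that contains `t`. -/
noncomputable def jumpLeft (μ : Measure ℝ) (t : ℝ) : ℝ :=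
  Function.leftLim (cdf μ) (quantile (cdf μ) t)

/-- The right end `F(F⁻¹(t))` of the jump interval of `F = cdf μ` that contains `t`. -/
noncomputable def jumpRight (μ : Measure ℝ) (t : ℝ) : ℝ := cdf μ (quantile (cdf μ) t)

lemma leftLim_cdf_nonneg (μ : Measure ℝ) (x : ℝ) : 0 ≤ Function.leftLim (cdf μ) x :=
  (cdf_nonneg μ (x - 1)).trans ((monotone_cdf μ).le_leftLim (by linarith))

lemma leftLim_cdf_le_one (μ : Measure ℝ) (x : ℝ) : Function.leftLim (cdf μ) x ≤ 1 :=
  ((monotone_cdf μ).leftLim_le le_rfl).trans (cdf_le_one μ x)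

lemma cdf_mem_Icc (μ : Measure ℝ) (x : ℝ) : cdf μ x ∈ Icc (0 : ℝ) 1 :=
  ⟨cdf_nonneg μ x, cdf_le_one μ x⟩

lemma leftLim_cdf_mem_Icc (μ : Measure ℝ) (x : ℝ) :
    Function.leftLim (cdf μ) x ∈ Icc (0 : ℝ) 1 :=
  ⟨leftLim_cdf_nonneg μ x, leftLim_cdf_le_one μ x⟩

/-- The Galois connection between a distribution function and its generalized inverse. -/
lemma quantile_le_iff (μ : Measure ℝ) {t : ℝ} (ht : t ∈ Ioo (0 : ℝ) 1) (x : ℝ) :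
    quantile (cdf μ) t ≤ x ↔ t ≤ cdf μ x := by
  have hne : {x | t ≤ cdf μ x}.Nonempty := by
    obtain ⟨y, hy⟩ := ((tendsto_cdf_atTop μ).eventually (lt_mem_nhds ht.2)).exists
    exact ⟨y, hy.le⟩
  have hbdd : BddBelow {x | t ≤ cdf μ x} := by
    obtain ⟨y, hy⟩ := ((tendsto_cdf_atBot μ).eventually (gt_mem_nhds ht.1)).exists
    refine ⟨y, fun z hz => ?_⟩
    by_contra hlt
    exact absurd (hz.trans (monotone_cdf μ (not_le.1 hlt).le)) (not_le.2 hy)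
  refine ⟨fun h => ?_, fun h => csInf_le hbdd h⟩
  have hlim : Tendsto (cdf μ) (𝓝[>] x) (𝓝 (cdf μ x)) :=
    ((cdf μ).right_continuous x).tendsto.mono_left (nhdsWithin_mono _ Ioi_subset_Ici_self)
  refine ge_of_tendsto hlim ?_
  filter_upwards [self_mem_nhdsWithin] with y hy
  obtain ⟨z, hz, hzy⟩ := exists_lt_of_csInf_lt hne (lt_of_le_of_lt h hy)
  exact le_trans hz (monotone_cdf μ hzy.le)

lemma le_jumpRight (μ : Measure ℝ) {t : ℝ} (ht : t ∈ Ioo (0 : ℝ) 1) : t ≤ jumpRight μ t :=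
  (quantile_le_iff μ ht _).1 le_rfl

lemma jumpLeft_le (μ : Measure ℝ) {t : ℝ} (ht : t ∈ Ioo (0 : ℝ) 1) : jumpLeft μ t ≤ t := by
  refine le_of_tendsto ((monotone_cdf μ).tendsto_leftLim _) ?_
  filter_upwards [self_mem_nhdsWithin] with y hy
  by_contra h
  exact absurd ((quantile_le_iff μ ht y).2 (not_le.1 h).le) (not_le.2 hy)

lemma jumpRight_mem_Icc (μ : Measure ℝ) (t : ℝ) : jumpRight μ t ∈ Icc (0 : ℝ) 1 :=
  cdf_mem_Icc μ _

lemma jumpLeft_mem_Icc (μ : Measure ℝ) (t : ℝ) : jumpLeft μ t ∈ Icc (0 : ℝ) 1 :=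
  leftLim_cdf_mem_Icc μ _

lemma quantile_eq_of_mem_Ioc (μ : Measure ℝ) {t x : ℝ} (ht : t ∈ Ioo (0 : ℝ) 1)
    (h : t ∈ Ioc (Function.leftLim (cdf μ) x) (cdf μ x)) : quantile (cdf μ) t = x := by
  refine le_antisymm ((quantile_le_iff μ ht x).2 h.2) (not_lt.1 fun hlt => ?_)
  exact absurd ((le_jumpRight μ ht).trans ((monotone_cdf μ).le_leftLim hlt)) (not_le.2 h.1)

lemma measurable_quantile (μ : Measure ℝ) : Measurable (quantile (cdf μ)) := by
  refine measurable_of_Iic fun x => ?_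
  -- Outside `(0,1]` the infimum defining the quantile is a junk value.
  have h0 : ∀ t ≤ (0 : ℝ), quantile (cdf μ) t = 0 := fun t ht => by
    have : {x | t ≤ cdf μ x} = univ := eq_univ_of_forall fun y => ht.trans (cdf_nonneg μ y)
    rw [quantile, this, Real.sInf_univ]
  have h1 : ∀ t, (1 : ℝ) < t → quantile (cdf μ) t = 0 := fun t ht => by
    have : {x | t ≤ cdf μ x} = ∅ :=
      eq_empty_of_forall_notMem fun y hy => absurd (hy.trans (cdf_le_one μ y)) (not_le.2 ht)
    rw [quantile, this, Real.sInf_empty]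
  have hset : quantile (cdf μ) ⁻¹' Iic x = (Ioo 0 1 ∩ Iic (cdf μ x)) ∪
      (((Iic 0 ∪ Ioi 1) ∩ {_t | 0 ≤ x}) ∪ ({1} ∩ quantile (cdf μ) ⁻¹' Iic x)) := by
    ext t
    simp only [mem_preimage, mem_Iic, mem_union, mem_inter_iff, mem_Ioi, mem_ofPred_eq,
      mem_singleton_iff]
    rcases le_or_gt t 0 with ht | ht
    · rw [h0 t ht]
      have : t ≠ 1 := by linarith
      have h' : ¬ t ∈ Ioo (0 : ℝ) 1 := fun h => absurd h.1 (not_lt.2 ht)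
      tauto
    rcases lt_trichotomy t 1 with ht1 | ht1 | ht1
    · have h' : t ∈ Ioo (0 : ℝ) 1 := ⟨ht, ht1⟩
      rw [quantile_le_iff μ h']
      have := ht1.ne
      have := ht1.le
      have := not_le.2 ht
      have := not_lt.2 ht1.le
      tauto
    · subst ht1; simp
    · rw [h1 t ht1]
      have : t ≠ 1 := ht1.ne'
      have h' : ¬ t ∈ Ioo (0 : ℝ) 1 := fun h => absurd h.2 (not_lt.2 ht1.le)
      tauto
  rw [hset]
  refine (measurableSet_Ioo.inter measurableSet_Iic).union
    (((measurableSet_Iic.union measurableSet_Ioi).inter (MeasurableSet.const _)).union ?_)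
  exact (subsingleton_singleton.anti inter_subset_left).measurableSet

lemma quantile_mono (μ : Measure ℝ) {s t : ℝ} (hs : s ∈ Ioo (0 : ℝ) 1) (ht : t ∈ Ioo (0 : ℝ) 1)
    (hst : s ≤ t) : quantile (cdf μ) s ≤ quantile (cdf μ) t :=
  (quantile_le_iff μ hs _).2 (hst.trans (le_jumpRight μ ht))

lemma measurable_jumpLeft (μ : Measure ℝ) : Measurable (jumpLeft μ) :=
  (monotone_cdf μ).leftLim.measurable.comp (measurable_quantile μ)

lemma quantile_preimage_Iic_inter (μ : Measure ℝ) (x : ℝ) :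
    quantile (cdf μ) ⁻¹' Iic x ∩ Ioo 0 1 = Ioo 0 1 ∩ Ioc 0 (cdf μ x) := by
  ext t
  constructor
  · rintro ⟨h, ht⟩
    exact ⟨ht, ht.1, (quantile_le_iff μ ht x).1 h⟩
  · rintro ⟨ht, _, h⟩
    exact ⟨(quantile_le_iff μ ht x).2 h, ht⟩

/-- Up to a null set, the sublevel set of the quantile function at `x` is `(0, F x]`. -/
lemma unif_restrict_quantile_preimage_Iic (μ : Measure ℝ) (x : ℝ) :
    unif.restrict (quantile (cdf μ) ⁻¹' Iic x) = volume.restrict (Ioc 0 (cdf μ x)) := by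
  rw [unif, Measure.restrict_restrict (measurable_quantile μ measurableSet_Iic),
    quantile_preimage_Iic_inter]
  refine Measure.restrict_congr_set ?_
  filter_upwards [(Ioo_ae_eq_Ioc : Ioo (0 : ℝ) 1 =ᵐ[volume] Ioc (0 : ℝ) 1)] with t ht
  refine propext ⟨fun h => h.2, fun h => ⟨?_, h⟩⟩
  exact (iff_of_eq ht).2 ⟨h.1, h.2.trans (cdf_le_one μ x)⟩

/-- Up to a null set, the fiber of the quantile function over `x` is the jump interval at `x`. -/
lemma unif_restrict_quantile_preimage_singleton (μ : Measure ℝ) (x : ℝ) :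
    unif.restrict (quantile (cdf μ) ⁻¹' {x}) =
      volume.restrict (Ioc (Function.leftLim (cdf μ) x) (cdf μ x)) := by
  rw [unif, Measure.restrict_restrict (measurable_quantile μ (measurableSet_singleton x))]
  refine Measure.restrict_congr_set ?_
  have h : ∀ᵐ t : ℝ, t ≠ Function.leftLim (cdf μ) x := Measure.ae_ne volume _
  filter_upwards [(Ioo_ae_eq_Ioc : Ioo (0 : ℝ) 1 =ᵐ[volume] Ioc (0 : ℝ) 1), h] with t ht hne
  refine propext ⟨fun h => ?_, fun h => ?_⟩
  · obtain ⟨rfl, h2⟩ := h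
    exact ⟨lt_of_le_of_ne (jumpLeft_le μ h2) hne.symm, le_jumpRight μ h2⟩
  · have h2 : t ∈ Ioo (0 : ℝ) 1 := (iff_of_eq ht).2
      ⟨(leftLim_cdf_nonneg μ x).trans_lt h.1, h.2.trans (cdf_le_one μ x)⟩
    exact ⟨quantile_eq_of_mem_Ioc μ h2 h, h2⟩

lemma map_quantile_unif (μ : Measure ℝ) [IsProbabilityMeasure μ] :
    unif.map (quantile (cdf μ)) = μ := by
  have : IsProbabilityMeasure (unif.map (quantile (cdf μ))) :=
    Measure.isProbabilityMeasure_map (measurable_quantile μ).aemeasurable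
  refine Measure.ext_of_Iic _ _ fun x => ?_
  rw [Measure.map_apply (measurable_quantile μ) measurableSet_Iic,
    ← Measure.restrict_apply_univ, unif_restrict_quantile_preimage_Iic, Measure.restrict_apply_univ,
    Real.volume_Ioc, sub_zero, ofReal_cdf]

/-- Almost every point of a non-degenerate jump interval is not its right end point. -/
lemma ae_lt_jumpRight_or_eq_jumpLeft (μ : Measure ℝ) :
    ∀ᵐ t ∂unif, t < jumpRight μ t ∨ jumpLeft μ t = t := by
  have hc : (cdf μ '' {x | Function.leftLim (cdf μ) x ≠ cdf μ x}).Countable :=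
    (cdf μ).countable_leftLim_ne.image _
  filter_upwards [ae_unif_mem, ae_restrict_of_ae (hc.ae_notMem volume)] with t ht hnot
  by_contra! h
  refine hnot ⟨quantile (cdf μ) t, ?_, le_antisymm h.1 (le_jumpRight μ ht)⟩
  exact fun h' => h.2 (h'.trans (le_antisymm h.1 (le_jumpRight μ ht)))

/-- Convergence of the right ends of the jump intervals entails that of the left ends: these are
determined, as a supremum, by the right ends at smaller arguments. -/
lemma ae_tendsto_jumpLeft (μ : ℕ → Measure ℝ) (μ₀ : Measure ℝ)
    (h : ∀ᵐ t ∂unif, Tendsto (fun n => jumpRight (μ n) t) atTop (𝓝 (jumpRight μ₀ t))) :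
    ∀ᵐ t ∂unif, Tendsto (fun n => jumpLeft (μ n) t) atTop (𝓝 (jumpLeft μ₀ t)) := by
  -- Every subinterval of `(0,1)` contains a good `s`, where the right ends converge.
  have hdense : ∀ a b : ℝ, 0 ≤ a → a < b → b ≤ 1 → ∃ s, a < s ∧ s < b ∧
      Tendsto (fun n => jumpRight (μ n) s) atTop (𝓝 (jumpRight μ₀ s)) := by
    intro a b ha hab hb
    have h' := (ae_restrict_iff' measurableSet_Ioo).1 h
    by_contra! hcon
    have hnull : volume (Ioo a b) = 0 := by
      refine measure_mono_null (fun s hs => ?_) h'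
      simp only [mem_compl_iff, mem_ofPred_eq, Classical.not_imp]
      exact ⟨⟨ha.trans_lt hs.1, hs.2.trans_le hb⟩, hcon s hs.1 hs.2⟩
    rw [Real.volume_Ioo, ENNReal.ofReal_eq_zero] at hnull
    linarith
  filter_upwards [ae_unif_mem, ae_lt_jumpRight_or_eq_jumpLeft μ₀] with t ht hcase
  refine tendsto_order.2 ⟨fun a ha => ?_, fun b hb => ?_⟩
  -- Lower bound: a good `s` between `a` and `jumpLeft μ₀ t` lies in an earlier jump interval of the
  -- limit, hence eventually in an earlier one of `μ n`, so that `s ≤ jumpLeft (μ n) t`.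
  · rcases lt_or_ge a 0 with ha0 | ha0
    · exact Eventually.of_forall fun n => ha0.trans_le (jumpLeft_mem_Icc _ _).1
    obtain ⟨s, has, hst, hs⟩ := hdense a _ ha0 ha (jumpLeft_mem_Icc μ₀ t).2
    have hst' : s < t := hst.trans_le (jumpLeft_le μ₀ ht)
    have hs01 : s ∈ Ioo (0 : ℝ) 1 := ⟨ha0.trans_lt has, hst'.trans ht.2⟩
    have hlt : jumpRight μ₀ s < t := by
      by_contra hcon
      have hq : quantile (cdf μ₀) s = quantile (cdf μ₀) t :=
        le_antisymm (quantile_mono μ₀ hs01 ht hst'.le)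
          ((quantile_le_iff μ₀ ht _).2 (not_lt.1 hcon))
      have : jumpLeft μ₀ t ≤ s := by
        have := jumpLeft_le μ₀ hs01
        rwa [jumpLeft, hq] at this
      exact absurd hst (not_lt.2 this)
    filter_upwards [hs.eventually (gt_mem_nhds hlt)] with n hn
    have hq : quantile (cdf (μ n)) s < quantile (cdf (μ n)) t := by
      by_contra hcon
      exact absurd ((quantile_le_iff (μ n) ht _).1 (not_lt.1 hcon)) (not_le.2 hn)
    exact (has.trans_le (le_jumpRight (μ n) hs01)).trans_le ((monotone_cdf (μ n)).le_leftLim hq)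
  -- Upper bound: a good `s` in the same jump interval of the limit as `t`, and below `b`, lies
  -- eventually in the same jump interval of `μ n` as `t`, so that `jumpLeft (μ n) t ≤ s`.
  · rcases hcase with hR | hL
    · rcases lt_or_ge t b with htb | htb
      · exact Eventually.of_forall fun n => (jumpLeft_le (μ n) ht).trans_lt htb
      obtain ⟨s, hs1, hsb, hs⟩ := hdense _ b (jumpLeft_mem_Icc μ₀ t).1 hb (htb.trans ht.2.le)
      have hst : s < t := hsb.trans_le htb
      have hs01 : s ∈ Ioo (0 : ℝ) 1 :=
        ⟨(jumpLeft_mem_Icc μ₀ t).1.trans_lt hs1, hst.trans ht.2⟩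
      have hq : quantile (cdf μ₀) s = quantile (cdf μ₀) t :=
        quantile_eq_of_mem_Ioc μ₀ hs01 ⟨hs1, hst.le.trans (le_jumpRight μ₀ ht)⟩
      have hlt : t < jumpRight μ₀ s := by rw [jumpRight, hq]; exact hR
      filter_upwards [hs.eventually (lt_mem_nhds hlt)] with n hn
      have hqn : quantile (cdf (μ n)) s = quantile (cdf (μ n)) t :=
        le_antisymm (quantile_mono (μ n) hs01 ht hst.le)
          ((quantile_le_iff (μ n) ht _).2 hn.le)
      rw [jumpLeft, ← hqn]
      exact (jumpLeft_le (μ n) hs01).trans_lt hsb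
    · rw [hL] at hb
      exact Eventually.of_forall fun n => (jumpLeft_le (μ n) ht).trans_lt hb

/-! ### Sections of copulas -/

namespace IsCopula

variable {C : ℝ → ℝ → ℝ}

lemma sub_left_mem (hC : IsCopula C) {v : ℝ} (hv : v ∈ Icc (0 : ℝ) 1) {a b : ℝ}
    (ha : a ∈ Icc (0 : ℝ) 1) (hb : b ∈ Icc (0 : ℝ) 1) (hab : a ≤ b) :
    C b v - C a v ∈ Icc 0 (b - a) := by
  have h0 := hC.two_increasing a ha b hb 0 ⟨le_rfl, zero_le_one⟩ v hv hab hv.1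
  have h1 := hC.two_increasing a ha b hb v hv 1 ⟨zero_le_one, le_rfl⟩ hab hv.2
  rw [hC.zero_right a ha, hC.zero_right b hb] at h0
  rw [hC.one_right a ha, hC.one_right b hb] at h1
  exact ⟨by linarith, by linarith⟩

lemma swap (hC : IsCopula C) : IsCopula (fun u v => C v u) where
  zero_left := hC.zero_right
  zero_right := hC.zero_left
  one_left := hC.one_right
  one_right := hC.one_left
  two_increasing u₁ hu₁ u₂ hu₂ v₁ hv₁ v₂ hv₂ hu hv := by
    have := hC.two_increasing v₁ hv₁ v₂ hv₂ u₁ hu₁ u₂ hu₂ hv hu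
    linarith

lemma abs_sub_left_le (hC : IsCopula C) {v : ℝ} (hv : v ∈ Icc (0 : ℝ) 1) {a b : ℝ}
    (ha : a ∈ Icc (0 : ℝ) 1) (hb : b ∈ Icc (0 : ℝ) 1) : |C a v - C b v| ≤ |a - b| := by
  rcases le_total a b with h | h
  · have := hC.sub_left_mem hv ha hb h
    rw [abs_sub_comm, abs_sub_comm a, abs_of_nonneg this.1, abs_of_nonneg (sub_nonneg.2 h)]
    exact this.2
  · have := hC.sub_left_mem hv hb ha h
    rw [abs_of_nonneg this.1, abs_of_nonneg (sub_nonneg.2 h)]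
    exact this.2

lemma abs_sub_le (hC : IsCopula C) {u v u' v' : ℝ} (hu : u ∈ Icc (0 : ℝ) 1)
    (hv : v ∈ Icc (0 : ℝ) 1) (hu' : u' ∈ Icc (0 : ℝ) 1) (hv' : v' ∈ Icc (0 : ℝ) 1) :
    |C u v - C u' v'| ≤ |u - u'| + |v - v'| :=
  (_root_.abs_sub_le _ (C u' v) _).trans
    (add_le_add (hC.abs_sub_left_le hv hu hu') (hC.swap.abs_sub_left_le hu' hv hv'))

lemma continuousOn (hC : IsCopula C) :
    ContinuousOn (fun p : ℝ × ℝ => C p.1 p.2) (Icc (0 : ℝ) 1 ×ˢ Icc (0 : ℝ) 1) := by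
  intro p hp
  refine tendsto_iff_dist_tendsto_zero.2 ?_
  have hlim : Tendsto (fun q : ℝ × ℝ => |q.1 - p.1| + |q.2 - p.2|)
      (𝓝[Icc (0 : ℝ) 1 ×ˢ Icc (0 : ℝ) 1] p) (𝓝 0) := by
    have : Continuous fun q : ℝ × ℝ => |q.1 - p.1| + |q.2 - p.2| := by fun_prop
    refine (this.tendsto' p 0 ?_).mono_left nhdsWithin_le_nhds
    simp
  refine squeeze_zero' (Eventually.of_forall fun _ => dist_nonneg) ?_ hlim
  filter_upwards [self_mem_nhdsWithin] with q hq
  exact hC.abs_sub_le hq.1 hq.2 hp.1 hp.2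

lemma lipschitzOnWith (hC : IsCopula C) {u : ℝ} (hu : u ∈ Icc (0 : ℝ) 1) :
    LipschitzOnWith 1 (fun s => C s u) (Icc 0 1) :=
  LipschitzOnWith.of_dist_le_mul fun a ha b hb => by
    simpa [Real.dist_eq] using hC.abs_sub_left_le hu ha hb

lemma monotoneOn (hC : IsCopula C) {u : ℝ} (hu : u ∈ Icc (0 : ℝ) 1) :
    MonotoneOn (fun s => C s u) (Icc 0 1) := fun _ ha _ hb hab =>
  sub_nonneg.1 (hC.sub_left_mem hu ha hb hab).1

lemma ae_differentiableAt (hC : IsCopula C) {u : ℝ} (hu : u ∈ Icc (0 : ℝ) 1) :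
    ∀ᵐ t ∂unif, DifferentiableAt ℝ (fun s => C s u) t := by
  filter_upwards [ae_unif_mem,
    ae_restrict_of_ae (hC.lipschitzOnWith hu).ae_differentiableWithinAt_of_mem_real] with t ht h
  exact (h (Ioo_subset_Icc_self ht)).differentiableAt (Icc_mem_nhds ht.1 ht.2)

lemma partialFst_mem (hC : IsCopula C) {u t : ℝ} (hu : u ∈ Icc (0 : ℝ) 1)
    (ht : t ∈ Ioo (0 : ℝ) 1) : partialFst C t u ∈ Icc (0 : ℝ) 1 := by
  have hn : Icc (0 : ℝ) 1 ∈ 𝓝 t := Icc_mem_nhds ht.1 ht.2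
  refine ⟨?_, ?_⟩
  · rw [partialFst, ← derivWithin_of_mem_nhds hn]
    exact (hC.monotoneOn hu).derivWithin_nonneg
  · exact (le_abs_self _).trans
      (norm_deriv_le_of_lipschitzOn hn (hC.lipschitzOnWith hu))

/-- Sections of copulas are Lipschitz, hence integrals of their derivatives. -/
lemma integral_partialFst (hC : IsCopula C) {u a b : ℝ} (hu : u ∈ Icc (0 : ℝ) 1)
    (ha : 0 ≤ a) (hab : a ≤ b) (hb : b ≤ 1) :
    ∫ t in Ioc a b, partialFst C t u = C b u - C a u := by
  rw [← intervalIntegral.integral_of_le hab]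
  refine AbsolutelyContinuousOnInterval.integral_deriv_eq_sub (f := fun s => C s u) ?_
  refine ((hC.lipschitzOnWith hu).mono ?_).absolutelyContinuousOnInterval
  rw [uIcc_of_le hab]
  exact Icc_subset_Icc ha hb

lemma ae_partialFst_mono (hC : IsCopula C) {u v : ℝ} (hu : u ∈ Icc (0 : ℝ) 1)
    (hv : v ∈ Icc (0 : ℝ) 1) (huv : u ≤ v) :
    ∀ᵐ t ∂unif, partialFst C t u ≤ partialFst C t v := by
  filter_upwards [ae_unif_mem, hC.ae_differentiableAt hu, hC.ae_differentiableAt hv]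
    with t ht hdu hdv
  rw [← sub_nonneg, partialFst, partialFst, ← deriv_fun_sub hdv hdu,
    ← derivWithin_of_mem_nhds (Icc_mem_nhds ht.1 ht.2)]
  refine MonotoneOn.derivWithin_nonneg fun a ha b hb hab => ?_
  have := hC.two_increasing a ha b hb u hu v hv hab huv
  linarith

lemma partialFst_one (hC : IsCopula C) {t : ℝ} (ht : t ∈ Ioo (0 : ℝ) 1) :
    partialFst C t 1 = 1 := by
  have : (fun s => C s 1) =ᶠ[𝓝 t] fun s => s := by
    filter_upwards [Icc_mem_nhds ht.1 ht.2] with s hs using hC.one_right s hs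
  rw [partialFst, this.deriv_eq, deriv_id'']

lemma partialFst_zero (hC : IsCopula C) {t : ℝ} (ht : t ∈ Ioo (0 : ℝ) 1) :
    partialFst C t 0 = 0 := by
  have : (fun s => C s 0) =ᶠ[𝓝 t] fun _ => 0 := by
    filter_upwards [Icc_mem_nhds ht.1 ht.2] with s hs using hC.zero_right s hs
  rw [partialFst, this.deriv_eq, deriv_const]

lemma integrable_partialFst (hC : IsCopula C) {u : ℝ} (hu : u ∈ Icc (0 : ℝ) 1) :
    Integrable (fun t => partialFst C t u) unif := by
  refine Integrable.of_bound (C := 1) (measurable_deriv _).aestronglyMeasurable ?_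
  filter_upwards [ae_unif_mem] with t ht
  have := hC.partialFst_mem hu ht
  rw [Real.norm_eq_abs, abs_of_nonneg this.1]
  exact this.2

end IsCopula

/-! ### The generalized partial derivative as a conditional expectation -/

/-- The generalized partial derivative as a function of `x = G⁻¹(t)` for `G = cdf μ`. Where `G` does
not jump at `x`, the argument `t` is recovered as `G x`. -/
noncomputable def atomDensity (μ : Measure ℝ) (C : ℝ → ℝ → ℝ) (u x : ℝ) : ℝ :=
  if Function.leftLim (cdf μ) x < cdf μ x then
    (C (cdf μ x) u - C (Function.leftLim (cdf μ) x) u) / (cdf μ x - Function.leftLim (cdf μ) x)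
  else partialFst C (cdf μ x) u

lemma jumpRight_eq_of_not_lt {μ : Measure ℝ} {t : ℝ} (ht : t ∈ Ioo (0 : ℝ) 1)
    (h : ¬ jumpLeft μ t < jumpRight μ t) : jumpRight μ t = t :=
  le_antisymm ((not_lt.1 h).trans (jumpLeft_le μ ht)) (le_jumpRight μ ht)

lemma genPartialFst_eq_ite (μ : Measure ℝ) (C : ℝ → ℝ → ℝ) (t u : ℝ) :
    genPartialFst (cdf μ) C t u =
      if jumpLeft μ t < jumpRight μ t then
        (C (jumpRight μ t) u - C (jumpLeft μ t) u) / (jumpRight μ t - jumpLeft μ t)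
      else partialFst C t u := by
  unfold genPartialFst jumpLeft jumpRight
  congr

lemma genPartialFst_eq_atomDensity (μ : Measure ℝ) (C : ℝ → ℝ → ℝ) {t : ℝ}
    (ht : t ∈ Ioo (0 : ℝ) 1) (u : ℝ) :
    genPartialFst (cdf μ) C t u = atomDensity μ C u (quantile (cdf μ) t) := by
  rw [genPartialFst_eq_ite]
  change _ = if jumpLeft μ t < jumpRight μ t then
        (C (jumpRight μ t) u - C (jumpLeft μ t) u) / (jumpRight μ t - jumpLeft μ t)
      else partialFst C (jumpRight μ t) u
  split_ifs with h
  · rfl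
  · rw [jumpRight_eq_of_not_lt ht h]

section

variable {C : ℝ → ℝ → ℝ}

lemma measurable_atomDensity (hC : IsCopula C) (μ : Measure ℝ) {u : ℝ}
    (hu : u ∈ Icc (0 : ℝ) 1) : Measurable (atomDensity μ C u) := by
  have hF := (monotone_cdf μ).measurable
  have hL := (monotone_cdf μ).leftLim.measurable
  have hCF : Measurable fun x => C (cdf μ x) u :=
    Monotone.measurable fun x y hxy =>
      hC.monotoneOn hu (cdf_mem_Icc μ x) (cdf_mem_Icc μ y) (monotone_cdf μ hxy)
  have hCL : Measurable fun x => C (Function.leftLim (cdf μ) x) u :=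
    Monotone.measurable fun x y hxy =>
      hC.monotoneOn hu (leftLim_cdf_mem_Icc μ x) (leftLim_cdf_mem_Icc μ y)
        ((monotone_cdf μ).leftLim hxy)
  exact Measurable.ite (measurableSet_lt hL hF) ((hCF.sub hCL).div (hF.sub hL))
    ((measurable_deriv _).comp hF)

lemma genPartialFst_ae_eq (μ : Measure ℝ) (C : ℝ → ℝ → ℝ) (u : ℝ) :
    (fun t => genPartialFst (cdf μ) C t u) =ᵐ[unif]
      fun t => atomDensity μ C u (quantile (cdf μ) t) := by
  filter_upwards [ae_unif_mem] with t ht using genPartialFst_eq_atomDensity μ C ht u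

lemma aestronglyMeasurable_genPartialFst (hC : IsCopula C) (μ : Measure ℝ) {u : ℝ}
    (hu : u ∈ Icc (0 : ℝ) 1) :
    AEStronglyMeasurable (fun t => genPartialFst (cdf μ) C t u) unif :=
  ((measurable_atomDensity hC μ hu).comp
    (measurable_quantile μ)).aestronglyMeasurable.congr (genPartialFst_ae_eq μ C u).symm

lemma genPartialFst_mem (hC : IsCopula C) (μ : Measure ℝ) {t u : ℝ} (hu : u ∈ Icc (0 : ℝ) 1)
    (ht : t ∈ Ioo (0 : ℝ) 1) : genPartialFst (cdf μ) C t u ∈ Icc (0 : ℝ) 1 := by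
  rw [genPartialFst_eq_ite]
  split_ifs with h
  · have := hC.sub_left_mem hu (jumpLeft_mem_Icc μ t) (jumpRight_mem_Icc μ t) h.le
    exact ⟨div_nonneg this.1 (sub_pos.2 h).le, (div_le_one (sub_pos.2 h)).2 this.2⟩
  · exact hC.partialFst_mem hu ht

lemma ae_norm_genPartialFst_le (hC : IsCopula C) (μ : Measure ℝ) {u : ℝ}
    (hu : u ∈ Icc (0 : ℝ) 1) : ∀ᵐ t ∂unif, ‖genPartialFst (cdf μ) C t u‖ ≤ 1 := by
  filter_upwards [ae_unif_mem] with t ht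
  have := genPartialFst_mem hC μ hu ht
  rw [Real.norm_eq_abs, abs_of_nonneg this.1]
  exact this.2

lemma integrable_genPartialFst (hC : IsCopula C) (μ : Measure ℝ) {u : ℝ}
    (hu : u ∈ Icc (0 : ℝ) 1) : Integrable (fun t => genPartialFst (cdf μ) C t u) unif :=
  .of_bound (aestronglyMeasurable_genPartialFst hC μ hu) 1 (ae_norm_genPartialFst_le hC μ hu)

lemma ae_genPartialFst_mono (hC : IsCopula C) (μ : Measure ℝ) {u v : ℝ}
    (hu : u ∈ Icc (0 : ℝ) 1) (hv : v ∈ Icc (0 : ℝ) 1) (huv : u ≤ v) :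
    ∀ᵐ t ∂unif, genPartialFst (cdf μ) C t u ≤ genPartialFst (cdf μ) C t v := by
  filter_upwards [hC.ae_partialFst_mono hu hv huv] with t ht
  rw [genPartialFst_eq_ite, genPartialFst_eq_ite]
  split_ifs with h
  · have := hC.two_increasing _ (jumpLeft_mem_Icc μ t) _ (jumpRight_mem_Icc μ t) u hu v hv
      h.le huv
    exact div_le_div_of_nonneg_right (by linarith) (sub_pos.2 h).le
  · exact ht

lemma genPartialFst_one (hC : IsCopula C) (μ : Measure ℝ) {t : ℝ} (ht : t ∈ Ioo (0 : ℝ) 1) :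
    genPartialFst (cdf μ) C t 1 = 1 := by
  rw [genPartialFst_eq_ite]
  split_ifs with h
  · rw [hC.one_right _ (jumpRight_mem_Icc μ t), hC.one_right _ (jumpLeft_mem_Icc μ t),
      div_self (sub_pos.2 h).ne']
  · exact hC.partialFst_one ht

lemma genPartialFst_zero (hC : IsCopula C) (μ : Measure ℝ) {t : ℝ} (ht : t ∈ Ioo (0 : ℝ) 1) :
    genPartialFst (cdf μ) C t 0 = 0 := by
  rw [genPartialFst_eq_ite]
  split_ifs with h
  · rw [hC.zero_right _ (jumpRight_mem_Icc μ t), hC.zero_right _ (jumpLeft_mem_Icc μ t),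
      sub_self, zero_div]
  · exact hC.partialFst_zero ht

/-- On a fiber over an atom the generalized partial derivative is the mean of the partial
derivative. -/
lemma setIntegral_genPartialFst_fiber (hC : IsCopula C) (μ : Measure ℝ) {u x : ℝ}
    (hu : u ∈ Icc (0 : ℝ) 1) (hx : Function.leftLim (cdf μ) x < cdf μ x) :
    ∫ t in quantile (cdf μ) ⁻¹' {x}, genPartialFst (cdf μ) C t u ∂unif =
      ∫ t in quantile (cdf μ) ⁻¹' {x}, partialFst C t u ∂unif := by
  have h1 : ∫ t in quantile (cdf μ) ⁻¹' {x}, genPartialFst (cdf μ) C t u ∂unif =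
      ∫ t in quantile (cdf μ) ⁻¹' {x}, atomDensity μ C u x ∂unif := by
    refine setIntegral_congr_ae (measurable_quantile μ (measurableSet_singleton x)) ?_
    filter_upwards [genPartialFst_ae_eq μ C u] with t ht htx
    rw [mem_preimage, mem_singleton_iff] at htx
    rw [ht, htx]
  rw [h1, unif_restrict_quantile_preimage_singleton,
    hC.integral_partialFst hu (leftLim_cdf_nonneg μ x) hx.le (cdf_le_one μ x), integral_const,
    atomDensity, if_pos hx]
  simp only [measureReal_restrict_apply_univ, Real.volume_real_Ioc_of_le hx.le, smul_eq_mul]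
  exact mul_div_cancel₀ _ (sub_pos.2 hx).ne'

lemma setIntegral_genPartialFst (hC : IsCopula C) (μ : Measure ℝ) {u : ℝ}
    (hu : u ∈ Icc (0 : ℝ) 1) {B : Set ℝ} (hB : MeasurableSet B) :
    ∫ t in quantile (cdf μ) ⁻¹' B, genPartialFst (cdf μ) C t u ∂unif =
      ∫ t in quantile (cdf μ) ⁻¹' B, partialFst C t u ∂unif := by
  -- Split at the fibers over the countable set `J` of atoms; off them the integrands agree.
  set J : Set ℝ := {x | Function.leftLim (cdf μ) x < cdf μ x} with hJ
  have hJc : J.Countable := (cdf μ).countable_leftLim_ne.mono fun x hx => ne_of_lt hx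
  have hQ := measurable_quantile μ
  have hg := integrable_genPartialFst hC μ hu
  have hp := hC.integrable_partialFst hu
  rw [← integral_inter_add_sdiff (hQ hJc.measurableSet) hg.integrableOn,
    ← integral_inter_add_sdiff (hQ hJc.measurableSet) hp.integrableOn]
  congr 1
  · have : Countable ↥(B ∩ J) := (hJc.mono inter_subset_right).to_subtype
    have hU : quantile (cdf μ) ⁻¹' B ∩ quantile (cdf μ) ⁻¹' J =
        ⋃ x : ↥(B ∩ J), quantile (cdf μ) ⁻¹' {(x : ℝ)} := by
      ext t
      simp only [mem_inter_iff, mem_preimage, mem_iUnion, mem_singleton_iff]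
      exact ⟨fun h => ⟨⟨_, h⟩, rfl⟩, by rintro ⟨x, hx⟩; rw [hx]; exact x.2⟩
    have hm : ∀ x : ↥(B ∩ J), MeasurableSet (quantile (cdf μ) ⁻¹' {(x : ℝ)}) :=
      fun x => hQ (measurableSet_singleton _)
    have hd : Pairwise (Function.onFun Disjoint
        fun x : ↥(B ∩ J) => quantile (cdf μ) ⁻¹' {(x : ℝ)}) := fun x y hxy =>
      Disjoint.preimage _ (disjoint_singleton.2 fun h => hxy (Subtype.ext h))
    rw [hU, integral_iUnion hm hd hg.integrableOn, integral_iUnion hm hd hp.integrableOn]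
    exact tsum_congr fun x => setIntegral_genPartialFst_fiber hC μ hu x.2.2
  · refine setIntegral_congr_fun ((hQ hB).diff (hQ hJc.measurableSet)) fun t ht => ?_
    rw [genPartialFst_eq_ite, if_neg]
    exact ht.2

/-- The generalized partial derivative is the conditional expectation, under the uniform
distribution, of the partial derivative given the quantile function. -/
lemma genPartialFst_ae_eq_condExp (hC : IsCopula C) (μ : Measure ℝ) {u : ℝ}
    (hu : u ∈ Icc (0 : ℝ) 1) :
    (fun t => genPartialFst (cdf μ) C t u) =ᵐ[unif]
      unif[fun t => partialFst C t u |
        MeasurableSpace.comap (quantile (cdf μ)) inferInstance] := by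
  refine ae_eq_condExp_of_forall_setIntegral_eq (measurable_quantile μ).comap_le
    (hC.integrable_partialFst hu)
    (fun _ _ _ => (integrable_genPartialFst hC μ hu).integrableOn) ?_ ?_
  · rintro _ ⟨B, hB, rfl⟩ _
    exact setIntegral_genPartialFst hC μ hu hB
  · refine ⟨fun t => atomDensity μ C u (quantile (cdf μ) t), ?_, genPartialFst_ae_eq μ C u⟩
    exact ((measurable_atomDensity hC μ hu).comp
      (comap_measurable (quantile (cdf μ)))).stronglyMeasurable

lemma integral_abs_genPartialFst_sub_le {C' : ℝ → ℝ → ℝ} (hC : IsCopula C) (hC' : IsCopula C')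
    (μ : Measure ℝ) {u : ℝ} (hu : u ∈ Icc (0 : ℝ) 1) :
    ∫ t, |genPartialFst (cdf μ) C t u - genPartialFst (cdf μ) C' t u| ∂unif ≤
      ∫ t, |partialFst C t u - partialFst C' t u| ∂unif := by
  refine le_trans (le_of_eq (integral_congr_ae ?_))
    (integral_abs_condExp_le (m := MeasurableSpace.comap (quantile (cdf μ)) inferInstance) _)
  filter_upwards [genPartialFst_ae_eq_condExp hC μ hu, genPartialFst_ae_eq_condExp hC' μ hu,
    condExp_sub (hC.integrable_partialFst hu) (hC'.integrable_partialFst hu)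
      (MeasurableSpace.comap (quantile (cdf μ)) inferInstance)] with t h1 h2 h3
  rw [h1, h2]
  exact congrArg abs h3.symm

end

/-! ### Convergence of the generalized partial derivatives -/

/-- Difference quotients over intervals that contain `t` and shrink to it converge to the
derivative at `t`. -/
lemma HasDerivAt.tendsto_straddle {f : ℝ → ℝ} {f' t : ℝ} (hf : HasDerivAt f f' t) {a b : ℕ → ℝ}
    (ha : Tendsto a atTop (𝓝 t)) (hb : Tendsto b atTop (𝓝 t)) (hat : ∀ n, a n ≤ t)
    (htb : ∀ n, t ≤ b n) :
    Tendsto (fun n => if a n < b n then (f (b n) - f (a n)) / (b n - a n) else f') atTop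
      (𝓝 f') := by
  refine Metric.tendsto_atTop'.2 fun ε hε => ?_
  have hO := (hasDerivAt_iff_isLittleO.1 hf).def (half_pos hε)
  obtain ⟨N, hN⟩ := eventually_atTop.1 ((ha.eventually hO).and (hb.eventually hO))
  refine ⟨N, fun n hn => ?_⟩
  obtain ⟨h1, h2⟩ := hN n hn.le
  split_ifs with hlt
  · have hpos : 0 < b n - a n := sub_pos.2 hlt
    simp only [Real.norm_eq_abs, smul_eq_mul] at h1 h2
    rw [abs_of_nonpos (sub_nonpos.2 (hat n))] at h1
    rw [abs_of_nonneg (sub_nonneg.2 (htb n))] at h2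
    have heq : (f (b n) - f (a n)) / (b n - a n) - f' =
        ((f (b n) - f t - (b n - t) * f') - (f (a n) - f t - (a n - t) * f')) /
          (b n - a n) := by
      field_simp
      ring
    rw [Real.dist_eq, heq, abs_div, abs_of_pos hpos, div_lt_iff₀ hpos]
    refine (abs_sub _ _).trans_lt ?_
    nlinarith
  · simpa using hε

section

variable {C₀ : ℝ → ℝ → ℝ}

lemma ae_tendsto_genPartialFst (hC₀ : IsCopula C₀) (μ : ℕ → Measure ℝ) (μ₀ : Measure ℝ)
    (h : ∀ᵐ t ∂unif, Tendsto (fun n => jumpRight (μ n) t) atTop (𝓝 (jumpRight μ₀ t)))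
    {u : ℝ} (hu : u ∈ Icc (0 : ℝ) 1) :
    ∀ᵐ t ∂unif, Tendsto (fun n => genPartialFst (cdf (μ n)) C₀ t u) atTop
      (𝓝 (genPartialFst (cdf μ₀) C₀ t u)) := by
  filter_upwards [h, ae_tendsto_jumpLeft μ μ₀ h, ae_unif_mem, hC₀.ae_differentiableAt hu]
    with t hR hL ht hd
  simp only [genPartialFst_eq_ite]
  split_ifs with hlt
  · have hcont : ∀ {a : ℕ → ℝ} {a₀ : ℝ}, (∀ n, a n ∈ Icc (0 : ℝ) 1) → a₀ ∈ Icc (0 : ℝ) 1 →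
        Tendsto a atTop (𝓝 a₀) → Tendsto (fun n => C₀ (a n) u) atTop (𝓝 (C₀ a₀ u)) :=
      fun ha ha₀ hlim => ((hC₀.lipschitzOnWith hu).continuousOn _ ha₀).tendsto.comp
        (tendsto_nhdsWithin_iff.2 ⟨hlim, Eventually.of_forall ha⟩)
    have hCR := hcont (fun n => jumpRight_mem_Icc (μ n) t) (jumpRight_mem_Icc μ₀ t) hR
    have hCL := hcont (fun n => jumpLeft_mem_Icc (μ n) t) (jumpLeft_mem_Icc μ₀ t) hL
    refine ((hCR.sub hCL).div (hR.sub hL) (sub_pos.2 hlt).ne').congr' ?_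
    filter_upwards [hL.eventually_lt hR hlt] with n hn
    rw [if_pos hn]
    rfl
  · have hRt : jumpRight μ₀ t = t := jumpRight_eq_of_not_lt ht hlt
    have hLt : jumpLeft μ₀ t = t :=
      le_antisymm (jumpLeft_le μ₀ ht) (hRt.ge.trans (not_lt.1 hlt))
    rw [hRt] at hR
    rw [hLt] at hL
    exact hd.hasDerivAt.tendsto_straddle hL hR (fun n => jumpLeft_le (μ n) ht)
      fun n => le_jumpRight (μ n) ht

variable {C : ℕ → ℝ → ℝ → ℝ}

lemma integrable_abs_genPartialFst_sub {D D' : ℝ → ℝ → ℝ} (hD : IsCopula D) (hD' : IsCopula D')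
    (μ μ' : Measure ℝ) {u : ℝ} (hu : u ∈ Icc (0 : ℝ) 1) :
    Integrable (fun t => |genPartialFst (cdf μ) D t u - genPartialFst (cdf μ') D' t u|) unif :=
  ((integrable_genPartialFst hD μ hu).sub (integrable_genPartialFst hD' μ' hu)).abs

/-- The generalized partial derivatives converge in `L¹`: replacing `C n` by `C₀` costs at most
the `L¹`-distance of the ordinary partial derivatives, as conditional expectations are
`L¹`-contractions, and the jump intervals converge. -/
lemma tendsto_integral_abs_genPartialFst_sub (hC : ∀ n, IsCopula (C n)) (hC₀ : IsCopula C₀)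
    (μ : ℕ → Measure ℝ) (μ₀ : Measure ℝ) (hp : PartialFstTendsto C C₀)
    (h : ∀ᵐ t ∂unif, Tendsto (fun n => jumpRight (μ n) t) atTop (𝓝 (jumpRight μ₀ t)))
    {u : ℝ} (hu : u ∈ Icc (0 : ℝ) 1) :
    Tendsto (fun n => ∫ t, |genPartialFst (cdf (μ n)) (C n) t u -
      genPartialFst (cdf μ₀) C₀ t u| ∂unif) atTop (𝓝 0) := by
  have hdom : Tendsto (fun n => ∫ t, |genPartialFst (cdf (μ n)) C₀ t u -
      genPartialFst (cdf μ₀) C₀ t u| ∂unif) atTop (𝓝 0) := by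
    have := tendsto_integral_of_dominated_convergence (μ := unif) (f := fun _ => (0 : ℝ))
      (F := fun n t => |genPartialFst (cdf (μ n)) C₀ t u - genPartialFst (cdf μ₀) C₀ t u|)
      (fun _ => 1 + 1)
      (fun n => ((aestronglyMeasurable_genPartialFst hC₀ (μ n) hu).sub
        (aestronglyMeasurable_genPartialFst hC₀ μ₀ hu)).norm)
      (integrable_const _)
      (fun n => by
        filter_upwards [ae_norm_genPartialFst_le hC₀ (μ n) hu, ae_norm_genPartialFst_le hC₀ μ₀ hu]
          with t h1 h2
        rw [Real.norm_eq_abs, abs_abs]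
        exact (norm_sub_le _ _).trans (add_le_add h1 h2))
      (by
        filter_upwards [ae_tendsto_genPartialFst hC₀ μ μ₀ h hu] with t ht
        simpa using (ht.sub_const (genPartialFst (cdf μ₀) C₀ t u)).abs)
    simpa using this
  refine squeeze_zero (fun n => integral_nonneg fun t => abs_nonneg _) (fun n => ?_)
    (by simpa using (hp u hu).add hdom)
  have hi1 := integrable_abs_genPartialFst_sub (hC n) hC₀ (μ n) (μ n) hu
  have hi2 := integrable_abs_genPartialFst_sub hC₀ hC₀ (μ n) μ₀ hu
  calc _ ≤ ∫ t, (|genPartialFst (cdf (μ n)) (C n) t u - genPartialFst (cdf (μ n)) C₀ t u| +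
        |genPartialFst (cdf (μ n)) C₀ t u - genPartialFst (cdf μ₀) C₀ t u|) ∂unif :=
        integral_mono (integrable_abs_genPartialFst_sub (hC n) hC₀ (μ n) μ₀ hu) (hi1.add hi2)
          fun t => abs_sub_le _ _ _
    _ ≤ _ := by
        rw [integral_add hi1 hi2]
        exact add_le_add_left (integral_abs_genPartialFst_sub_le (hC n) hC₀ (μ n) hu) _

/-! ### The Markov product copula -/

lemma integrable_genPartialFst_mul {D D' : ℝ → ℝ → ℝ} (hD : IsCopula D) (hD' : IsCopula D')
    (μ μ' : Measure ℝ) {u v : ℝ} (hu : u ∈ Icc (0 : ℝ) 1) (hv : v ∈ Icc (0 : ℝ) 1) :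
    Integrable (fun t => genPartialFst (cdf μ) D t u * genPartialFst (cdf μ') D' t v) unif :=
  (integrable_genPartialFst hD' μ' hv).bdd_mul (c := 1)
    (aestronglyMeasurable_genPartialFst hD μ hu) (ae_norm_genPartialFst_le hD μ hu)

lemma integral_genPartialFst {D : ℝ → ℝ → ℝ} (hD : IsCopula D) (μ : Measure ℝ)
    {u : ℝ} (hu : u ∈ Icc (0 : ℝ) 1) : ∫ t, genPartialFst (cdf μ) D t u ∂unif = u := by
  have h := setIntegral_genPartialFst hD μ hu MeasurableSet.univ
  rw [preimage_univ, Measure.restrict_univ] at h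
  rw [h, unif, ← integral_Ioc_eq_integral_Ioo,
    hD.integral_partialFst hu le_rfl zero_le_one le_rfl, hD.one_left u hu, hD.zero_left u hu,
    sub_zero]

lemma markovCopula_comm (G : ℝ → ℝ) (D : ℝ → ℝ → ℝ) (u v : ℝ) :
    markovCopula G D u v = markovCopula G D v u := by
  simp only [markovCopula, mul_comm]

lemma isCopula_markovCopula {D : ℝ → ℝ → ℝ} (hD : IsCopula D) (μ : Measure ℝ) :
    IsCopula (markovCopula (cdf μ) D) := by
  have hzero : ∀ v, markovCopula (cdf μ) D 0 v = 0 := fun v => by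
    rw [markovCopula, setIntegral_congr_fun measurableSet_Ioo (g := fun _ => (0 : ℝ))
      fun t ht => by simp [genPartialFst_zero hD μ ht], integral_zero]
  have hone : ∀ v ∈ Icc (0 : ℝ) 1, markovCopula (cdf μ) D 1 v = v := fun v hv => by
    rw [markovCopula, setIntegral_congr_fun measurableSet_Ioo
      (g := fun t => genPartialFst (cdf μ) D t v)
      fun t ht => by simp [genPartialFst_one hD μ ht], integral_genPartialFst hD μ hv]
  refine ⟨fun v _ => hzero v, fun u _ => (markovCopula_comm _ _ _ _).trans (hzero u), hone,
    fun u hu => (markovCopula_comm _ _ _ _).trans (hone u hu), ?_⟩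
  intro u₁ hu₁ u₂ hu₂ v₁ hv₁ v₂ hv₂ hu hv
  have hi := fun {u v : ℝ} (hu : u ∈ Icc (0 : ℝ) 1) (hv : v ∈ Icc (0 : ℝ) 1) =>
    integrable_genPartialFst_mul hD hD μ μ hu hv
  have h₁ : Integrable (fun t => genPartialFst (cdf μ) D t u₂ * genPartialFst (cdf μ) D t v₂ -
      genPartialFst (cdf μ) D t u₁ * genPartialFst (cdf μ) D t v₂) unif :=
    (hi hu₂ hv₂).sub (hi hu₁ hv₂)
  have h₂ : Integrable (fun t => genPartialFst (cdf μ) D t u₂ * genPartialFst (cdf μ) D t v₂ -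
      genPartialFst (cdf μ) D t u₁ * genPartialFst (cdf μ) D t v₂ -
      genPartialFst (cdf μ) D t u₂ * genPartialFst (cdf μ) D t v₁) unif :=
    h₁.sub (hi hu₂ hv₁)
  -- The volume of a rectangle is the integral of a product of nonnegative increments.
  have heq : markovCopula (cdf μ) D u₂ v₂ - markovCopula (cdf μ) D u₁ v₂ -
      markovCopula (cdf μ) D u₂ v₁ + markovCopula (cdf μ) D u₁ v₁ =
      ∫ t, (genPartialFst (cdf μ) D t u₂ - genPartialFst (cdf μ) D t u₁) *
        (genPartialFst (cdf μ) D t v₂ - genPartialFst (cdf μ) D t v₁) ∂unif := by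
    rw [integral_congr_ae (Eventually.of_forall fun t =>
      show _ = genPartialFst (cdf μ) D t u₂ * genPartialFst (cdf μ) D t v₂ -
        genPartialFst (cdf μ) D t u₁ * genPartialFst (cdf μ) D t v₂ -
        genPartialFst (cdf μ) D t u₂ * genPartialFst (cdf μ) D t v₁ +
        genPartialFst (cdf μ) D t u₁ * genPartialFst (cdf μ) D t v₁ by ring),
      integral_add h₂ (hi hu₁ hv₁), integral_sub h₁ (hi hu₂ hv₁),
      integral_sub (hi hu₂ hv₂) (hi hu₁ hv₂)]
    rfl
  rw [heq]
  refine integral_nonneg_of_ae ?_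
  filter_upwards [ae_genPartialFst_mono hD μ hu₁ hu₂ hu, ae_genPartialFst_mono hD μ hv₁ hv₂ hv]
    with t h1 h2
  exact mul_nonneg (sub_nonneg.2 h1) (sub_nonneg.2 h2)

lemma tendsto_markovCopula (hC : ∀ n, IsCopula (C n)) (hC₀ : IsCopula C₀)
    (μ : ℕ → Measure ℝ) (μ₀ : Measure ℝ) (hp : PartialFstTendsto C C₀)
    (h : ∀ᵐ t ∂unif, Tendsto (fun n => jumpRight (μ n) t) atTop (𝓝 (jumpRight μ₀ t)))
    {u v : ℝ} (hu : u ∈ Icc (0 : ℝ) 1) (hv : v ∈ Icc (0 : ℝ) 1) :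
    Tendsto (fun n => markovCopula (cdf (μ n)) (C n) u v) atTop
      (𝓝 (markovCopula (cdf μ₀) C₀ u v)) := by
  have hlim := (tendsto_integral_abs_genPartialFst_sub hC hC₀ μ μ₀ hp h hu).add
    (tendsto_integral_abs_genPartialFst_sub hC hC₀ μ μ₀ hp h hv)
  rw [add_zero] at hlim
  rw [tendsto_iff_dist_tendsto_zero]
  refine squeeze_zero (fun n => dist_nonneg) (fun n => ?_) hlim
  have hiu := integrable_abs_genPartialFst_sub (hC n) hC₀ (μ n) μ₀ hu
  have hiv := integrable_abs_genPartialFst_sub (hC n) hC₀ (μ n) μ₀ hv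
  rw [← integral_add hiu hiv, Real.dist_eq, markovCopula, markovCopula,
    ← integral_sub (integrable_genPartialFst_mul (hC n) (hC n) (μ n) (μ n) hu hv)
      (integrable_genPartialFst_mul hC₀ hC₀ μ₀ μ₀ hu hv)]
  refine (abs_integral_le_integral_abs).trans (integral_mono_ae
    ((integrable_genPartialFst_mul (hC n) (hC n) (μ n) (μ n) hu hv).sub
      (integrable_genPartialFst_mul hC₀ hC₀ μ₀ μ₀ hu hv)).abs (hiu.add hiv) ?_)
  filter_upwards [ae_norm_genPartialFst_le (hC n) (μ n) hv, ae_norm_genPartialFst_le hC₀ μ₀ hu]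
    with t h1 h2
  rw [Real.norm_eq_abs] at h1 h2
  set a := genPartialFst (cdf (μ n)) (C n) t u
  set b := genPartialFst (cdf (μ n)) (C n) t v
  set a₀ := genPartialFst (cdf μ₀) C₀ t u
  set b₀ := genPartialFst (cdf μ₀) C₀ t v
  change |a * b - a₀ * b₀| ≤ |a - a₀| + |b - b₀|
  have hsplit : a * b - a₀ * b₀ = (a - a₀) * b + a₀ * (b - b₀) := by ring
  rw [hsplit]
  refine (abs_add_le _ _).trans (add_le_add ?_ ?_)
  · rw [abs_mul]
    exact mul_le_of_le_one_right (abs_nonneg _) h1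
  · rw [abs_mul]
    exact mul_le_of_le_one_left (abs_nonneg _) h2

/-- Copulas are equicontinuous, so that pointwise convergence is uniform. -/
lemma tendstoUniformlyOn_of_isCopula (hC : ∀ n, IsCopula (C n)) (hC₀ : IsCopula C₀)
    (h : ∀ u ∈ Icc (0 : ℝ) 1, ∀ v ∈ Icc (0 : ℝ) 1,
      Tendsto (fun n => C n u v) atTop (𝓝 (C₀ u v))) :
    TendstoUniformlyOn (fun (n : ℕ) (p : ℝ × ℝ) => C n p.1 p.2) (fun p : ℝ × ℝ => C₀ p.1 p.2)
      atTop (Icc (0 : ℝ) 1 ×ˢ Icc (0 : ℝ) 1) := by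
  rw [← tendstoLocallyUniformlyOn_iff_tendstoUniformlyOn_of_compact
    (isCompact_Icc.prod isCompact_Icc), Metric.tendstoLocallyUniformlyOn_iff]
  intro ε hε p hp
  have hopen : ∀ᶠ q : ℝ × ℝ in 𝓝 p, |q.1 - p.1| + |q.2 - p.2| < ε / 3 := by
    have hc : Continuous fun q : ℝ × ℝ => |q.1 - p.1| + |q.2 - p.2| := by fun_prop
    exact (hc.tendsto' p 0 (by simp)).eventually (gt_mem_nhds (by linarith))
  refine ⟨_, inter_mem self_mem_nhdsWithin (mem_nhdsWithin_of_mem_nhds hopen), ?_⟩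
  filter_upwards [Metric.tendsto_nhds.1 (h _ hp.1 _ hp.2) (ε / 3) (by linarith)]
    with n hn q hq
  have hq2 : |q.1 - p.1| + |q.2 - p.2| < ε / 3 := hq.2
  have h1 := (hC n).abs_sub_le hq.1.1 hq.1.2 hp.1 hp.2
  have h2 := hC₀.abs_sub_le hq.1.1 hq.1.2 hp.1 hp.2
  rw [Real.dist_eq] at hn ⊢
  rw [abs_lt] at hn ⊢
  rw [abs_le] at h1 h2
  constructor <;> linarith [hn.1, hn.2, h1.1, h1.2, h2.1, h2.2]

end

/-! ### Copulas of the law of the Markov product -/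

section

variable {Ω : Type*} [MeasurableSpace Ω] {P : Measure Ω} [IsProbabilityMeasure P] {X Y : Ω → ℝ}
  {C : ℝ → ℝ → ℝ}

/-- The joint law of `(X, Y)` disintegrated along the quantile transform of `X`: both sides are
finite measures in `B` that agree on the half-lines `Iic x`, by the copula identity. -/
lemma setIntegral_partialFst_quantile_preimage (hX : Measurable X) (hY : Measurable Y)
    (hC : IsCopulaOf C (P.map fun ω => (X ω, Y ω))) (y : ℝ) {B : Set ℝ} (hB : MeasurableSet B) :
    ∫ t in quantile (cdf (P.map X)) ⁻¹' B, partialFst C t (cdf (P.map Y) y) ∂unif =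
      P.real (X ⁻¹' B ∩ Y ⁻¹' Iic y) := by
  set μ := P.map X with hμ
  set u := cdf (P.map Y) y with hu_def
  have hu : u ∈ Icc (0 : ℝ) 1 := cdf_mem_Icc _ y
  have hQ := measurable_quantile μ
  have hpos : ∀ᵐ t ∂unif, 0 ≤ partialFst C t u := by
    filter_upwards [ae_unif_mem] with t ht using (hC.1.partialFst_mem hu ht).1
  have hint := hC.1.integrable_partialFst hu
  have key : ∀ B, MeasurableSet B →
      ((unif.withDensity fun t => ENNReal.ofReal (partialFst C t u)).map (quantile (cdf μ))) B =
        ENNReal.ofReal (∫ t in quantile (cdf μ) ⁻¹' B, partialFst C t u ∂unif) := fun B hB => by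
    rw [Measure.map_apply hQ hB, withDensity_apply _ (hQ hB),
      ofReal_integral_eq_lintegral_ofReal hint.integrableOn (ae_restrict_of_ae hpos)]
  have hext : (P.restrict (Y ⁻¹' Iic y)).map X =
      (unif.withDensity fun t => ENNReal.ofReal (partialFst C t u)).map (quantile (cdf μ)) := by
    refine Measure.ext_of_Iic _ _ fun x => ?_
    have hx := hC.2 x y
    rw [Measure.fst_map_prodMk hY, Measure.snd_map_prodMk hX, ← hμ, ← hu_def] at hx
    rw [key _ measurableSet_Iic, unif_restrict_quantile_preimage_Iic,
      hC.1.integral_partialFst hu le_rfl (cdf_nonneg μ x) (cdf_le_one μ x),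
      hC.1.zero_left u hu, sub_zero, ← hx,
      map_measureReal_apply (hX.prodMk hY) (measurableSet_Iic.prod measurableSet_Iic),
      ofReal_measureReal, Measure.map_apply hX measurableSet_Iic,
      Measure.restrict_apply (hX measurableSet_Iic)]
    rfl
  have h := key B hB
  rw [← hext, Measure.map_apply hX hB, Measure.restrict_apply (hX hB)] at h
  rw [measureReal_def, h,
    ENNReal.toReal_ofReal (integral_nonneg_of_ae (ae_restrict_of_ae hpos))]

lemma measurable_condDistrib_real {A : Set ℝ} (hA : MeasurableSet A) :
    Measurable fun x => (condDistrib Y X P x).real A :=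
  (Kernel.measurable_coe _ hA).ennreal_toReal

lemma integrable_condDistrib_real {A : Set ℝ} (hA : MeasurableSet A) (μ : Measure ℝ)
    [IsFiniteMeasure μ] : Integrable (fun x => (condDistrib Y X P x).real A) μ :=
  .of_bound (measurable_condDistrib_real hA).aestronglyMeasurable 1
    (Eventually.of_forall fun x => by
      rw [Real.norm_eq_abs, abs_of_nonneg measureReal_nonneg]
      exact measureReal_le_one)

lemma setIntegral_condDistrib_real (hX : Measurable X) (hY : Measurable Y) {A B : Set ℝ}
    (hA : MeasurableSet A) (hB : MeasurableSet B) :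
    ∫ x in B, (condDistrib Y X P x).real A ∂(P.map X) = P.real (X ⁻¹' B ∩ Y ⁻¹' A) := by
  simp_rw [measureReal_def]
  rw [integral_toReal (Kernel.measurable_coe _ hA).aemeasurable
    (Eventually.of_forall fun x => measure_lt_top _ _),
    Measure.restrict_map hX hB, lintegral_map (Kernel.measurable_coe _ hA) hX,
    setLIntegral_preimage_condDistrib hX hY.aemeasurable hA hB]

/-- The generalized partial derivative is the conditional distribution function of `Y` given
that `X` is the `t`-quantile of its law. -/
lemma condDistrib_quantile_ae_eq (hX : Measurable X) (hY : Measurable Y)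
    (hC : IsCopulaOf C (P.map fun ω => (X ω, Y ω))) (y : ℝ) :
    (fun t => (condDistrib Y X P (quantile (cdf (P.map X)) t)).real (Iic y)) =ᵐ[unif]
      fun t => genPartialFst (cdf (P.map X)) C t (cdf (P.map Y) y) := by
  have hu : (cdf (P.map Y) y : ℝ) ∈ Icc (0 : ℝ) 1 := cdf_mem_Icc _ y
  have : IsProbabilityMeasure (P.map X) := Measure.isProbabilityMeasure_map hX.aemeasurable
  have hQ := measurable_quantile (P.map X)
  have hm := measurable_condDistrib_real (P := P) (X := X) (Y := Y) (measurableSet_Iic (a := y))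
  refine (ae_eq_condExp_of_forall_setIntegral_eq hQ.comap_le
    (hC.1.integrable_partialFst hu) ?_ ?_ ?_).trans
      (genPartialFst_ae_eq_condExp hC.1 (P.map X) hu).symm
  · intro _ _ _
    refine Integrable.integrableOn ?_
    refine Integrable.comp_measurable (g := fun x => (condDistrib Y X P x).real (Iic y)) ?_ hQ
    exact integrable_condDistrib_real measurableSet_Iic _
  · rintro _ ⟨B, hB, rfl⟩ _
    rw [setIntegral_partialFst_quantile_preimage hX hY hC y hB,
      ← setIntegral_condDistrib_real hX hY measurableSet_Iic hB]
    conv_rhs => rw [← map_quantile_unif (P.map X)]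
    rw [setIntegral_map hB hm.aestronglyMeasurable hQ.aemeasurable]
  · exact (hm.comp (comap_measurable _)).stronglyMeasurable.aestronglyMeasurable

lemma markovProductLaw_apply_prod {A B : Set ℝ} (hA : MeasurableSet A) (hB : MeasurableSet B) :
    markovProductLaw P X Y (A ×ˢ B) =
      ∫⁻ x, condDistrib Y X P x A * condDistrib Y X P x B ∂(P.map X) := by
  rw [markovProductLaw, Measure.bind_apply (hA.prod hB) (Kernel.aemeasurable _)]
  simp_rw [Kernel.prod_apply, Measure.prod_prod]

lemma markovProductLaw_real_prod {A B : Set ℝ} (hA : MeasurableSet A) (hB : MeasurableSet B) :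
    (markovProductLaw P X Y).real (A ×ˢ B) =
      ∫ x, (condDistrib Y X P x).real A * (condDistrib Y X P x).real B ∂(P.map X) := by
  simp_rw [measureReal_def, ← ENNReal.toReal_mul]
  rw [integral_toReal, markovProductLaw_apply_prod hA hB]
  · exact ((Kernel.measurable_coe _ hA).mul (Kernel.measurable_coe _ hB)).aemeasurable
  · exact Eventually.of_forall fun x => ENNReal.mul_lt_top (measure_lt_top _ _) (measure_lt_top _ _)

lemma lintegral_condDistrib (hX : Measurable X) (hY : Measurable Y) {A : Set ℝ}
    (hA : MeasurableSet A) : ∫⁻ x, condDistrib Y X P x A ∂(P.map X) = P.map Y A := by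
  rw [← condDistrib_comp_map hX.aemeasurable hY.aemeasurable,
    Measure.bind_apply hA (Kernel.aemeasurable _)]

lemma fst_markovProductLaw (hX : Measurable X) (hY : Measurable Y) :
    (markovProductLaw P X Y).fst = P.map Y := by
  ext A hA
  rw [Measure.fst_apply hA, ← prod_univ, markovProductLaw_apply_prod hA MeasurableSet.univ,
    ← lintegral_condDistrib hX hY hA]
  simp

lemma snd_markovProductLaw (hX : Measurable X) (hY : Measurable Y) :
    (markovProductLaw P X Y).snd = P.map Y := by
  ext A hA
  rw [Measure.snd_apply hA, ← univ_prod, markovProductLaw_apply_prod MeasurableSet.univ hA,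
    ← lintegral_condDistrib hX hY hA]
  simp

instance : IsFiniteMeasure (markovProductLaw P X Y) := by
  refine ⟨?_⟩
  rw [← univ_prod_univ, markovProductLaw_apply_prod MeasurableSet.univ MeasurableSet.univ]
  simp

lemma isCopulaOf_markovCopula (hX : Measurable X) (hY : Measurable Y)
    (hC : IsCopulaOf C (P.map fun ω => (X ω, Y ω))) :
    IsCopulaOf (markovCopula (cdf (P.map X)) C) (markovProductLaw P X Y) := by
  have : IsProbabilityMeasure (P.map X) := Measure.isProbabilityMeasure_map hX.aemeasurable
  refine ⟨isCopula_markovCopula hC.1 _, fun x y => ?_⟩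
  rw [fst_markovProductLaw hX hY, snd_markovProductLaw hX hY,
    markovProductLaw_real_prod measurableSet_Iic measurableSet_Iic]
  conv_lhs => rw [← map_quantile_unif (P.map X)]
  have hm : Measurable fun z => (condDistrib Y X P z).real (Iic x) *
      (condDistrib Y X P z).real (Iic y) :=
    (measurable_condDistrib_real measurableSet_Iic).mul
      (measurable_condDistrib_real measurableSet_Iic)
  rw [integral_map (measurable_quantile _).aemeasurable hm.aestronglyMeasurable, markovCopula]
  refine integral_congr_ae ?_
  filter_upwards [condDistrib_quantile_ae_eq hX hY hC x, condDistrib_quantile_ae_eq hX hY hC y]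
    with t h1 h2
  rw [← h1, ← h2]

end

/-! ### Chatterjee's rank correlation in terms of the Markov product copula -/

lemma measureReal_Iio_eq_leftLim_cdf (μ : Measure ℝ) [IsProbabilityMeasure μ] (y : ℝ) :
    μ.real (Iio y) = Function.leftLim (cdf μ) y := by
  have h : μ (Iio y) = ENNReal.ofReal (Function.leftLim (cdf μ) y) := by
    conv_lhs => rw [← measure_cdf μ]
    rw [StieltjesFunction.measure_Iio _ (tendsto_cdf_atBot μ), sub_zero]
  rw [measureReal_def, h, ENNReal.toReal_ofReal (leftLim_cdf_nonneg μ y)]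

/-- The copula identity with left limits, by continuity of copulas. -/
lemma IsCopulaOf.measureReal_Iio_prod_Iio {D : ℝ → ℝ → ℝ} {ν : Measure (ℝ × ℝ)}
    [IsFiniteMeasure ν] (hD : IsCopulaOf D ν) (x y : ℝ) :
    ν.real (Iio x ×ˢ Iio y) =
      D (Function.leftLim (cdf ν.fst) x) (Function.leftLim (cdf ν.snd) y) := by
  obtain ⟨a, ha, hax, hal⟩ := exists_seq_strictMono_tendsto x
  obtain ⟨b, hb, hby, hbl⟩ := exists_seq_strictMono_tendsto y
  have hU : (⋃ n, Iic (a n) ×ˢ Iic (b n)) = Iio x ×ˢ Iio y := by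
    ext p
    simp only [mem_iUnion, mem_prod, mem_Iic, mem_Iio]
    constructor
    · rintro ⟨n, h1, h2⟩
      exact ⟨h1.trans_lt (hax n), h2.trans_lt (hby n)⟩
    · rintro ⟨h1, h2⟩
      obtain ⟨n, hn1, hn2⟩ :=
        ((hal.eventually (lt_mem_nhds h1)).and (hbl.eventually (lt_mem_nhds h2))).exists
      exact ⟨n, hn1.le, hn2.le⟩
  have hmono : Monotone fun n => Iic (a n) ×ˢ Iic (b n) := fun m n hmn =>
    prod_mono (Iic_subset_Iic.2 (ha.monotone hmn)) (Iic_subset_Iic.2 (hb.monotone hmn))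
  have h1 : Tendsto (fun n => ν.real (Iic (a n) ×ˢ Iic (b n))) atTop
      (𝓝 (ν.real (Iio x ×ˢ Iio y))) := by
    have := tendsto_measure_iUnion_atTop (μ := ν) hmono
    rw [hU] at this
    exact (ENNReal.tendsto_toReal (measure_ne_top ν _)).comp this
  have hl : ∀ (μ : Measure ℝ) {c : ℕ → ℝ} {z : ℝ}, (∀ n, c n < z) → Tendsto c atTop (𝓝 z) →
      Tendsto (fun n => cdf μ (c n)) atTop (𝓝 (Function.leftLim (cdf μ) z)) :=
    fun μ c z hc hcl => ((monotone_cdf μ).tendsto_leftLim z).comp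
      (tendsto_nhdsWithin_iff.2 ⟨hcl, Eventually.of_forall hc⟩)
  have h2 : Tendsto (fun n => D (cdf ν.fst (a n)) (cdf ν.snd (b n))) atTop
      (𝓝 (D (Function.leftLim (cdf ν.fst) x) (Function.leftLim (cdf ν.snd) y))) := by
    have hcont := hD.1.continuousOn (Function.leftLim (cdf ν.fst) x,
      Function.leftLim (cdf ν.snd) y) ⟨leftLim_cdf_mem_Icc _ _, leftLim_cdf_mem_Icc _ _⟩
    exact hcont.tendsto.comp (tendsto_nhdsWithin_iff.2
      ⟨(hl _ hax hal).prodMk_nhds (hl _ hby hbl),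
        Eventually.of_forall fun n => ⟨cdf_mem_Icc _ _, cdf_mem_Icc _ _⟩⟩)
  simp_rw [hD.2] at h1
  exact tendsto_nhds_unique h1 h2

section

variable {Ω : Type*} [MeasurableSpace Ω] {P : Measure Ω} [IsProbabilityMeasure P] {X Y : Ω → ℝ}
  {C : ℝ → ℝ → ℝ}

lemma variance_condDistrib_Ici (hX : Measurable X) (hY : Measurable Y)
    (hC : IsCopulaOf C (P.map fun ω => (X ω, Y ω))) (y : ℝ) :
    variance (fun ω => (condDistrib Y X P (X ω)).real (Ici y)) P =
      markovCopula (cdf (P.map X)) C (Function.leftLim (cdf (P.map Y)) y)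
        (Function.leftLim (cdf (P.map Y)) y) - Function.leftLim (cdf (P.map Y)) y ^ 2 := by
  have hpY : IsProbabilityMeasure (P.map Y) := Measure.isProbabilityMeasure_map hY.aemeasurable
  have hm : Measurable fun x => (condDistrib Y X P x).real (Iio y) :=
    measurable_condDistrib_real measurableSet_Iio
  have hmX : Measurable fun ω => (condDistrib Y X P (X ω)).real (Iio y) := hm.comp hX
  -- `P(Y ≥ y | X) = 1 - P(Y < y | X)` has the variance of `P(Y < y | X)`, whose second moment is
  -- the mass that the law of the Markov product gives to `Iio y ×ˢ Iio y`.
  have hcompl : (fun ω => (condDistrib Y X P (X ω)).real (Ici y)) =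
      fun ω => 1 - (condDistrib Y X P (X ω)).real (Iio y) := by
    funext ω
    rw [← compl_Iio, probReal_compl_eq_one_sub measurableSet_Iio]
  have hL : MemLp (fun ω => (condDistrib Y X P (X ω)).real (Iio y)) 2 P :=
    .of_bound hmX.aestronglyMeasurable 1 (Eventually.of_forall fun ω => by
      rw [Real.norm_eq_abs, abs_of_nonneg measureReal_nonneg]
      exact measureReal_le_one)
  rw [hcompl, variance_const_sub hmX.aestronglyMeasurable, variance_eq_sub hL]
  have h1 : P[fun ω => (condDistrib Y X P (X ω)).real (Iio y)] =
      Function.leftLim (cdf (P.map Y)) y := by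
    rw [← integral_map (φ := X) (f := fun x => (condDistrib Y X P x).real (Iio y))
      hX.aemeasurable hm.aestronglyMeasurable, ← setIntegral_univ,
      setIntegral_condDistrib_real hX hY measurableSet_Iio MeasurableSet.univ, preimage_univ,
      univ_inter, ← map_measureReal_apply hY measurableSet_Iio, measureReal_Iio_eq_leftLim_cdf]
  have h2 : P[(fun ω => (condDistrib Y X P (X ω)).real (Iio y)) ^ 2] =
      markovCopula (cdf (P.map X)) C (Function.leftLim (cdf (P.map Y)) y)
        (Function.leftLim (cdf (P.map Y)) y) := by
    have hmm : Measurable fun x =>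
        (condDistrib Y X P x).real (Iio y) * (condDistrib Y X P x).real (Iio y) := hm.mul hm
    have h := (isCopulaOf_markovCopula hX hY hC).measureReal_Iio_prod_Iio y y
    rw [fst_markovProductLaw hX hY, snd_markovProductLaw hX hY,
      markovProductLaw_real_prod measurableSet_Iio measurableSet_Iio,
      integral_map hX.aemeasurable hmm.aestronglyMeasurable] at h
    rw [← h]
    exact integral_congr_ae (Eventually.of_forall fun ω => sq _)
  rw [h1, h2]

lemma variance_indicator_le (hY : Measurable Y) (y : ℝ) :
    variance ({ω | y ≤ Y ω}.indicator (fun _ => (1 : ℝ))) P =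
      Function.leftLim (cdf (P.map Y)) y - Function.leftLim (cdf (P.map Y)) y ^ 2 := by
  have hpY : IsProbabilityMeasure (P.map Y) := Measure.isProbabilityMeasure_map hY.aemeasurable
  have hs : MeasurableSet {ω | y ≤ Y ω} := measurableSet_le measurable_const hY
  have hp : P.real {ω | y ≤ Y ω} = 1 - Function.leftLim (cdf (P.map Y)) y := by
    rw [← measureReal_Iio_eq_leftLim_cdf, ← probReal_compl_eq_one_sub measurableSet_Iio,
      compl_Iio, map_measureReal_apply hY measurableSet_Ici]
    rfl
  have hsq : ({ω | y ≤ Y ω}.indicator (fun _ => (1 : ℝ))) ^ 2 =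
      {ω | y ≤ Y ω}.indicator (fun _ => (1 : ℝ)) := by
    funext ω
    by_cases h : ω ∈ {ω | y ≤ Y ω} <;> simp [h]
  rw [variance_eq_sub (memLp_indicator_const 2 hs 1 (Or.inr (measure_ne_top _ _))), hsq,
    integral_indicator_const _ hs, hp, smul_eq_mul, mul_one]
  ring

lemma IsCopula.measurable_diag_comp {D : ℝ → ℝ → ℝ} (hD : IsCopula D) (μ : Measure ℝ) :
    Measurable fun y => D (Function.leftLim (cdf μ) y) (Function.leftLim (cdf μ) y) := by
  refine Monotone.measurable fun x y hxy => ?_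
  have h := (monotone_cdf μ).leftLim hxy
  have hx := leftLim_cdf_mem_Icc μ x
  have hy := leftLim_cdf_mem_Icc μ y
  exact (hD.monotoneOn hx hx hy h).trans (hD.swap.monotoneOn hy hx hy h)

/-- After the quantile transform, Chatterjee's rank correlation only depends on the Markov
product copula and on the left ends of the jump intervals of the distribution function of `Y`. -/
lemma chatterjeeXi_eq (hX : Measurable X) (hY : Measurable Y)
    (hC : IsCopulaOf C (P.map fun ω => (X ω, Y ω))) :
    chatterjeeXi P Y X =
      (∫ t, (markovCopula (cdf (P.map X)) C (jumpLeft (P.map Y) t) (jumpLeft (P.map Y) t) -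
        jumpLeft (P.map Y) t ^ 2) ∂unif) /
      ∫ t, (jumpLeft (P.map Y) t - jumpLeft (P.map Y) t ^ 2) ∂unif := by
  have hpY : IsProbabilityMeasure (P.map Y) := Measure.isProbabilityMeasure_map hY.aemeasurable
  have hL : Measurable (Function.leftLim (cdf (P.map Y))) := (monotone_cdf _).leftLim.measurable
  have key : ∀ f : ℝ → ℝ, Measurable f →
      ∫ y, f y ∂(P.map Y) = ∫ t, f (quantile (cdf (P.map Y)) t) ∂unif := fun f hf => by
    conv_lhs => rw [← map_quantile_unif (P.map Y)]
    exact integral_map (measurable_quantile _).aemeasurable hf.aestronglyMeasurable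
  simp only [chatterjeeXi, variance_condDistrib_Ici hX hY hC, variance_indicator_le hY]
  congr 1
  · exact key _ (((isCopula_markovCopula hC.1 _).measurable_diag_comp _).sub (hL.pow_const 2))
  · exact key _ (hL.sub (hL.pow_const 2))

/-- The denominator of Chatterjee's rank correlation is positive for non-degenerate `Y`: if
`F(F⁻¹(t)-) = 0` for almost all `t`, then `F⁻¹` is constant on `(0,1)`. -/
lemma integral_jumpLeft_sub_sq_pos (hY : Measurable Y) (hne : ¬ ∃ c : ℝ, Y =ᵐ[P] fun _ => c) :
    0 < ∫ t, (jumpLeft (P.map Y) t - jumpLeft (P.map Y) t ^ 2) ∂unif := by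
  have hpY : IsProbabilityMeasure (P.map Y) := Measure.isProbabilityMeasure_map hY.aemeasurable
  set μ := P.map Y with hμ
  have hnn : ∀ t, 0 ≤ jumpLeft μ t - jumpLeft μ t ^ 2 := fun t => by
    have := jumpLeft_mem_Icc μ t
    nlinarith [this.1, this.2]
  have hint : Integrable (fun t => jumpLeft μ t - jumpLeft μ t ^ 2) unif :=
    .of_bound ((measurable_jumpLeft μ).sub
      ((measurable_jumpLeft μ).pow_const 2)).aestronglyMeasurable 1
      (Eventually.of_forall fun t => by
        have := jumpLeft_mem_Icc μ t
        rw [Real.norm_eq_abs, abs_of_nonneg (hnn t)]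
        nlinarith [this.1, this.2])
  refine lt_of_le_of_ne (integral_nonneg hnn) fun h0 => hne ?_
  have hae : ∀ᵐ t ∂unif, jumpLeft μ t = 0 := by
    filter_upwards [(integral_eq_zero_iff_of_nonneg hnn hint).1 h0.symm, ae_unif_mem]
      with t h1 ht
    have h2 : jumpLeft μ t * (1 - jumpLeft μ t) = 0 := by
      rw [Pi.zero_apply] at h1
      rw [← h1]
      ring
    rcases mul_eq_zero.1 h2 with h | h
    · exact h
    · linarith [jumpLeft_le μ ht, ht.2]
  have hconst : ∀ s ∈ Ioo (0 : ℝ) 1, ∀ t ∈ Ioo (0 : ℝ) 1, jumpLeft μ t = 0 →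
      quantile (cdf μ) t ≤ quantile (cdf μ) s := fun s hs t ht h => by
    by_contra! hlt
    have := (le_jumpRight μ hs).trans ((monotone_cdf μ).le_leftLim hlt)
    rw [← jumpLeft, h] at this
    exact absurd hs.1 (not_lt.2 this)
  obtain ⟨t₀, h₀, ht₀⟩ := (hae.and ae_unif_mem).exists
  refine ⟨quantile (cdf μ) t₀, ?_⟩
  have hq : ∀ᵐ t ∂unif, quantile (cdf μ) t = quantile (cdf μ) t₀ := by
    filter_upwards [hae, ae_unif_mem] with t h ht
    exact le_antisymm (hconst _ ht₀ _ ht h) (hconst _ ht _ ht₀ h₀)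
  have hy : ∀ᵐ y ∂(unif.map (quantile (cdf μ))), y = quantile (cdf μ) t₀ :=
    (ae_map_iff (measurable_quantile μ).aemeasurable
      (measurableSet_eq_fun measurable_id measurable_const)).2 hq
  rw [map_quantile_unif, hμ] at hy
  exact ae_of_ae_map hY.aemeasurable hy

end

/-! ### Convergence of the rank correlation -/

lemma norm_sub_sq_le_two {a b : ℝ} (ha : a ∈ Icc (0 : ℝ) 1) (hb : b ∈ Icc (0 : ℝ) 1) :
    ‖a - b ^ 2‖ ≤ 2 := by
  have h := pow_le_one₀ (n := 2) hb.1 hb.2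
  rw [Real.norm_eq_abs, abs_le]
  constructor <;> linarith [ha.1, ha.2, sq_nonneg b]

lemma tendsto_integral_jumpLeft_sub_sq (μ : ℕ → Measure ℝ) (μ₀ : Measure ℝ)
    (hL : ∀ᵐ t ∂unif, Tendsto (fun n => jumpLeft (μ n) t) atTop (𝓝 (jumpLeft μ₀ t))) :
    Tendsto (fun n => ∫ t, (jumpLeft (μ n) t - jumpLeft (μ n) t ^ 2) ∂unif) atTop
      (𝓝 (∫ t, (jumpLeft μ₀ t - jumpLeft μ₀ t ^ 2) ∂unif)) := by
  refine tendsto_integral_of_dominated_convergence (fun _ => 2)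
    (fun n => ((measurable_jumpLeft (μ n)).sub
      ((measurable_jumpLeft (μ n)).pow_const 2)).aestronglyMeasurable)
    (integrable_const _)
    (fun n => Eventually.of_forall fun t =>
      norm_sub_sq_le_two (jumpLeft_mem_Icc (μ n) t) (jumpLeft_mem_Icc (μ n) t)) ?_
  filter_upwards [hL] with t ht using ht.sub (ht.pow 2)

lemma tendsto_integral_diag_sub_sq {M : ℕ → ℝ → ℝ → ℝ} {M₀ : ℝ → ℝ → ℝ}
    (hM : ∀ n, IsCopula (M n)) (hM₀ : IsCopula M₀)
    (hunif : TendstoUniformlyOn (fun (n : ℕ) (p : ℝ × ℝ) => M n p.1 p.2)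
      (fun p : ℝ × ℝ => M₀ p.1 p.2) atTop (Icc (0 : ℝ) 1 ×ˢ Icc (0 : ℝ) 1))
    (μ : ℕ → Measure ℝ) (μ₀ : Measure ℝ)
    (hL : ∀ᵐ t ∂unif, Tendsto (fun n => jumpLeft (μ n) t) atTop (𝓝 (jumpLeft μ₀ t))) :
    Tendsto (fun n => ∫ t, (M n (jumpLeft (μ n) t) (jumpLeft (μ n) t) - jumpLeft (μ n) t ^ 2)
      ∂unif) atTop
      (𝓝 (∫ t, (M₀ (jumpLeft μ₀ t) (jumpLeft μ₀ t) - jumpLeft μ₀ t ^ 2) ∂unif)) := by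
  have hmeas : ∀ n, Measurable fun t =>
      M n (jumpLeft (μ n) t) (jumpLeft (μ n) t) - jumpLeft (μ n) t ^ 2 := fun n =>
    (((hM n).measurable_diag_comp (μ n)).comp (measurable_quantile (μ n))).sub
      ((measurable_jumpLeft (μ n)).pow_const 2)
  refine tendsto_integral_of_dominated_convergence (fun _ => 2)
    (fun n => (hmeas n).aestronglyMeasurable) (integrable_const _)
    (fun n => Eventually.of_forall fun t => ?_) ?_
  · have hj := jumpLeft_mem_Icc (μ n) t
    have h1 := (hM n).sub_left_mem hj ⟨le_rfl, zero_le_one⟩ hj hj.1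
    rw [(hM n).zero_left _ hj, sub_zero, sub_zero] at h1
    exact norm_sub_sq_le_two ⟨h1.1, h1.2.trans hj.2⟩ hj
  · filter_upwards [hL] with t ht
    have hmem : ∀ ν : Measure ℝ, (jumpLeft ν t, jumpLeft ν t) ∈
        Icc (0 : ℝ) 1 ×ˢ Icc (0 : ℝ) 1 :=
      fun ν => ⟨jumpLeft_mem_Icc ν t, jumpLeft_mem_Icc ν t⟩
    have hdiag : Tendsto (fun n => M n (jumpLeft (μ n) t) (jumpLeft (μ n) t)) atTop
        (𝓝 (M₀ (jumpLeft μ₀ t) (jumpLeft μ₀ t))) :=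
      hunif.tendsto_comp (g := fun n => (jumpLeft (μ n) t, jumpLeft (μ n) t))
        (hM₀.continuousOn _ (hmem μ₀)) (tendsto_nhdsWithin_iff.2
          ⟨ht.prodMk_nhds ht, Eventually.of_forall fun n => hmem (μ n)⟩)
    exact hdiag.sub (ht.pow 2)

theorem mainTheorem3 {Ω : ℕ → Type*} [∀ n, MeasurableSpace (Ω n)]
    {Ω₀ : Type*} [MeasurableSpace Ω₀]
    (P : ∀ n, Measure (Ω n)) [∀ n, IsProbabilityMeasure (P n)]
    (P₀ : Measure Ω₀) [IsProbabilityMeasure P₀]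
    (X Y : ∀ n, Ω n → ℝ) (X₀ Y₀ : Ω₀ → ℝ)
    (hX : ∀ n, Measurable (X n)) (hY : ∀ n, Measurable (Y n))
    (hX₀ : Measurable X₀) (hY₀ : Measurable Y₀)
    (C : ℕ → ℝ → ℝ → ℝ) (C₀ : ℝ → ℝ → ℝ)
    (hC : ∀ n, IsCopulaOf (C n) ((P n).map (fun ω => (X n ω, Y n ω))))
    (hC₀ : IsCopulaOf C₀ (P₀.map (fun ω => (X₀ ω, Y₀ ω))))
    (h_partial : PartialFstTendsto C C₀)
    (h_ranX : RangeTendsto (fun n => distFun (P n) (X n)) (distFun P₀ X₀)) :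
    (∀ n, IsCopulaOf (markovCopula (distFun (P n) (X n)) (C n))
      (markovProductLaw (P n) (X n) (Y n))) ∧
    IsCopulaOf (markovCopula (distFun P₀ X₀) C₀) (markovProductLaw P₀ X₀ Y₀) ∧
    TendstoUniformlyOn
      (fun (n : ℕ) (p : ℝ × ℝ) => markovCopula (distFun (P n) (X n)) (C n) p.1 p.2)
      (fun p : ℝ × ℝ => markovCopula (distFun P₀ X₀) C₀ p.1 p.2)
      atTop (Icc (0 : ℝ) 1 ×ˢ Icc (0 : ℝ) 1) ∧
    ((¬ ∃ c : ℝ, Y₀ =ᵐ[P₀] fun _ => c) →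
      RangeTendsto (fun n => distFun (P n) (Y n)) (distFun P₀ Y₀) →
      Tendsto (fun n => chatterjeeXi (P n) (Y n) (X n)) atTop
        (𝓝 (chatterjeeXi P₀ Y₀ X₀))) := by
  have hM : ∀ n, IsCopula (markovCopula (cdf ((P n).map (X n))) (C n)) :=
    fun n => isCopula_markovCopula (hC n).1 _
  have hM₀ : IsCopula (markovCopula (cdf (P₀.map X₀)) C₀) := isCopula_markovCopula hC₀.1 _
  have hunif := tendstoUniformlyOn_of_isCopula hM hM₀ fun u hu v hv =>
    tendsto_markovCopula (fun n => (hC n).1) hC₀.1 (fun n => (P n).map (X n)) (P₀.map X₀)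
      h_partial h_ranX hu hv
  refine ⟨fun n => isCopulaOf_markovCopula (hX n) (hY n) (hC n),
    isCopulaOf_markovCopula hX₀ hY₀ hC₀, hunif, fun hne h_ranY => ?_⟩
  have hL := ae_tendsto_jumpLeft (fun n => (P n).map (Y n)) (P₀.map Y₀) h_ranY
  simp only [fun n => chatterjeeXi_eq (hX n) (hY n) (hC n), chatterjeeXi_eq hX₀ hY₀ hC₀]
  exact (tendsto_integral_diag_sub_sq hM hM₀ hunif _ _ hL).div
    (tendsto_integral_jumpLeft_sub_sq _ _ hL) (integral_jumpLeft_sub_sq_pos hY₀ hne).ne'
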